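/- All graphs are finite and simple. Let $K$ be a field. For a graph $G$ let $J_G=(x_iy_j-x_jy_i : \{i,j\}\in E(G))\subset K[x_i,y_i : i\in V(G)]$ be its binomial edge ideal. An ideal is unmixed if all its minimal primes have the same height. The dual graph $\mathcal D(I)$ of an ideal $I$ has the minimal primes of $I$ as vertices, two distinct ones $\mathfrak p,\mathfrak q$ being adjacent if $\mathrm{ht}(\mathfrak p+\mathfrak q)-1=\mathrm{ht}(\mathfrak p)=\mathrm{ht}(\mathfrak q)=\mathrm{ht}(I)$. A vertex $v$ of $G$ is a cut vertex if $G\setminus\{v\}$ has more connected components than $G$, and a leaf is a vertex of degree one. For graphs $G_1,G_2$ with leaves $f_1,f_2$, the graph $(G_1,f_1)\ast(G_2,f_2)$ is obtained from the disjoint union of $G_1$ and $G_2$ by identifying $f_1$ with $f_2$; if moreover the neighbour $v_i$ of $f_i$ has degree at least $3$ in $G_i$ for $i=1,2$, the graph $(G_1,f_1)\circ(G_2,f_2)$ is obtained by removing $f_1,f_2$ and identifying $v_1$ with $v_2$. We write $G=G_1\ast G_2$ (respectively $G=G_1\circ G_2$) if $G$ is isomorphic to such a graph for some choice of the leaves.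 Let $G$ be a connected bipartite graph with at least three cut vertices and such that $J_G$ is unmixed. (a) There exist graphs $G_1$ and $G_2$ such that $G=G_1\ast G_2$ or $G=G_1\circ G_2$. (b) If $\mathcal D(J_G)$ is connected, then for all graphs $G_1,G_2$ with $G=G_1\ast G_2$ or $G=G_1\circ G_2$, both $\mathcal D(J_{G_1})$ and $\mathcal D(J_{G_2})$ are connected. -/

import Mathlib

universe u v w

namespace BinomialEdge

section Graphs

variable {V : Type u} {V₁ : Type v} {V₂ : Type w}

/-- The degree of a vertex of a (finite) graph. -/
noncomputable def deg (G : SimpleGraph V) (x : V) : ℕ := (G.neighborSet x).ncard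

/-- A leaf is a vertex of degree one. -/
def IsLeaf (G : SimpleGraph V) (f : V) : Prop := deg G f = 1

/-- `c_G(S)`: the number of connected components of the subgraph induced on the complement
of `S`. -/
noncomputable def compCount (G : SimpleGraph V) (S : Set V) : ℕ :=
  Nat.card (G.induce Sᶜ).ConnectedComponent

/-- `S` is a cut set of `G`: `S` is empty, or putting back any vertex of `S` lowers the number
of connected components of the graph that remains after the removal of `S`. -/
def IsCutSet (G : SimpleGraph V) (S : Set V) : Prop :=
  ∀ i ∈ S, compCount G (S \ {i}) < compCount G S

/-- A cut vertex is a cut set of cardinality one. -/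
def IsCutVertex (G : SimpleGraph V) (x : V) : Prop := IsCutSet G {x}

/-- The graph obtained from the disjoint union of `G₁` and `G₂` by identifying the vertex `a`
of `G₁` with the vertex `b` of `G₂`. The identified vertex is `Sum.inl a`. -/
def glue (G₁ : SimpleGraph V₁) (a : V₁) (G₂ : SimpleGraph V₂) (b : V₂) :
    SimpleGraph (V₁ ⊕ {y : V₂ // y ≠ b}) where
  Adj
    | Sum.inl x, Sum.inl x' => G₁.Adj x x'
    | Sum.inr y, Sum.inr y' => G₂.Adj y y'
    | Sum.inl x, Sum.inr y => x = a ∧ G₂.Adj b y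
    | Sum.inr y, Sum.inl x => x = a ∧ G₂.Adj b y
  symm := ⟨by
    rintro (x | y) (x' | y') h
    · exact SimpleGraph.Adj.symm h
    · exact h
    · exact h
    · exact SimpleGraph.Adj.symm h⟩
  loopless := ⟨by
    rintro (x | y) h
    · exact G₁.irrefl h
    · exact G₂.irrefl h⟩

/-- `G = (G₁, f₁) ∗ (G₂, f₂)` for some leaves `f₁` of `G₁` and `f₂` of `G₂`, up to isomorphism:
`G` is obtained from `G₁` and `G₂` by identifying `f₁` and `f₂`. -/
def IsStar (G : SimpleGraph V) (G₁ : SimpleGraph V₁) (G₂ : SimpleGraph V₂) : Prop :=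
  ∃ (f₁ : V₁) (f₂ : V₂), IsLeaf G₁ f₁ ∧ IsLeaf G₂ f₂ ∧ Nonempty (G ≃g glue G₁ f₁ G₂ f₂)

/-- The graph obtained from `G₁` and `G₂` by removing `f₁` and `f₂` and then identifying
their neighbours `v₁` and `v₂`. -/
def circ (G₁ : SimpleGraph V₁) {f₁ v₁ : V₁} (h₁ : G₁.Adj f₁ v₁)
    (G₂ : SimpleGraph V₂) {f₂ v₂ : V₂} (h₂ : G₂.Adj f₂ v₂) :
    SimpleGraph ({x : V₁ // x ≠ f₁} ⊕ {y : {y : V₂ // y ≠ f₂} // y ≠ ⟨v₂, h₂.ne'⟩}) :=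
  glue (G₁.comap (Subtype.val : {x : V₁ // x ≠ f₁} → V₁)) ⟨v₁, h₁.ne'⟩
    (G₂.comap (Subtype.val : {y : V₂ // y ≠ f₂} → V₂)) ⟨v₂, h₂.ne'⟩

/-- `G = (G₁, f₁) ∘ (G₂, f₂)` for some leaves `f₁` of `G₁` and `f₂` of `G₂` whose neighbours
`v₁` and `v₂` have degree at least three, up to isomorphism. -/
def IsCirc (G : SimpleGraph V) (G₁ : SimpleGraph V₁) (G₂ : SimpleGraph V₂) : Prop :=
  ∃ (f₁ v₁ : V₁) (h₁ : G₁.Adj f₁ v₁) (f₂ v₂ : V₂) (h₂ : G₂.Adj f₂ v₂),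
    IsLeaf G₁ f₁ ∧ IsLeaf G₂ f₂ ∧ 3 ≤ deg G₁ v₁ ∧ 3 ≤ deg G₂ v₂ ∧
      Nonempty (G ≃g circ G₁ h₁ G₂ h₂)

end Graphs

section Ideals

/-- An ideal is unmixed if all its minimal primes have the same height. -/
def Unmixed {R : Type u} [CommRing R] (I : Ideal R) : Prop :=
  ∀ p ∈ I.minimalPrimes, ∀ q ∈ I.minimalPrimes, p.height = q.height

/-- The dual graph of `I`: its vertices are the minimal primes of `I`, and `p`, `q` are adjacent
if `ht (p + q) - 1 = ht p = ht q = ht I`. -/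
def dualGraph {R : Type u} [CommRing R] (I : Ideal R) : SimpleGraph I.minimalPrimes where
  Adj p q := p ≠ q ∧ (p.1 ⊔ q.1).height = p.1.height + 1 ∧
    p.1.height = I.height ∧ q.1.height = I.height
  symm := ⟨by
    rintro p q ⟨hne, h, hp, hq⟩
    refine ⟨hne.symm, ?_, hq, hp⟩
    rw [sup_comm, h, hp, hq]⟩
  loopless := ⟨fun _ h => h.1 rfl⟩

/-- The binomial edge ideal of `G` in the polynomial ring over `K` in the variables
`x_i = X (Sum.inl i)` and `y_i = X (Sum.inr i)`, for `i : V`. -/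
noncomputable def binomialEdgeIdeal (K : Type v) [Field K] {V : Type u} (G : SimpleGraph V) :
    Ideal (MvPolynomial (V ⊕ V) K) :=
  Ideal.span {f | ∃ i j : V, G.Adj i j ∧
    f = MvPolynomial.X (Sum.inl i) * MvPolynomial.X (Sum.inr j)
      - MvPolynomial.X (Sum.inl j) * MvPolynomial.X (Sum.inr i)}

end Ideals

end BinomialEdge

/-! The minimal primes of $J_G$ are the ideals `cutIdeal K G S` with $S$ a cut set: modulo such a
prime the columns in $S$ vanish and the columns in one component of $G\setminus S$ are proportional.
The height is $|S|+|V|-c(S)$ (`labelIdeal_height`). For connected $G$, unmixedness therefore says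
$c(S)=|S|+1$ for every cut set (`CutUnmixed`), and adjacency in the dual graph becomes the relation
`CutAdj` on cut sets (`dualGraph_adj_iff`). From there on everything is combinatorics.

(b) In either decomposition $G_1$ sits in $G$ as an induced subgraph whose leaf $f$ stands for the
whole far side of a vertex $v$ (`LeafEmbedding`). Restricting cut sets of $G$ to $G_1\setminus f$
gives cut sets of $G_1$, reaches all of them, and sends adjacent cut sets to equal or adjacent ones;
so connectedness passes to $\mathcal D(J_{G_1})$. The crucial fact is `Split.exists_adj_left`: a cut
vertex $v$ lying in a cut set $S$ keeps a neighbour outside $S$ on both of its sides.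

(a) Counting with both colour classes shows that $G$ has exactly two leaves
(`CutUnmixed.ncard_leaves`). Among three cut vertices some $v$ is thus adjacent to no leaf, and
$G\setminus v$ has two components. One neighbour of $v$ on each side gives $\ast$, at least two on
each side give $\circ$. In the mixed case the single neighbour $w$ on one side has degree two, and
$G$ decomposes by $\ast$ at $w$: if both ends of the bridge $vw$ had two further neighbours,
recolouring one side of it and counting again would give at least three leaves
(`CutUnmixed.three_le_ncard_leaves`). -/

namespace BinomialEdge

open MvPolynomial

/-! ### Prime ideals of $2\times V$ matrices with prescribed zero and proportional columns -/

section LabelIdeals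

variable (K : Type v) [Field K] {V : Type u}

/-- The two-minor of the generic `2 × V` matrix on the columns `i` and `j`. -/
noncomputable def minor (i j : V) : MvPolynomial (V ⊕ V) K :=
  X (Sum.inl i) * X (Sum.inr j) - X (Sum.inl j) * X (Sum.inr i)

/-- The generic `2 × V` matrix in which the columns without label vanish and the columns with a
common label are proportional. -/
noncomputable def labelMap (l : V → Option ℕ) :
    MvPolynomial (V ⊕ V) K →ₐ[K] MvPolynomial (V ⊕ (ℕ ⊕ ℕ)) K :=
  aeval (Sum.elim
    (fun i => (l i).elim 0 (fun c => X (Sum.inl i) * X (Sum.inr (Sum.inl c))))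
    (fun i => (l i).elim 0 (fun c => X (Sum.inl i) * X (Sum.inr (Sum.inr c)))))

/-- The prime ideal of the matrices in which the columns without label vanish and the columns
with a common label are proportional. -/
noncomputable def labelIdeal (l : V → Option ℕ) : Ideal (MvPolynomial (V ⊕ V) K) :=
  RingHom.ker (labelMap K l)

instance labelIdeal_isPrime (l : V → Option ℕ) : (labelIdeal K l).IsPrime :=
  RingHom.ker_isPrime _

variable {K}

theorem labelMap_inl (l : V → Option ℕ) (i : V) : labelMap K l (X (Sum.inl i)) =
    (l i).elim 0 (fun c => X (Sum.inl i) * X (Sum.inr (Sum.inl c))) := by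
  simp [labelMap]

theorem labelMap_inr (l : V → Option ℕ) (i : V) : labelMap K l (X (Sum.inr i)) =
    (l i).elim 0 (fun c => X (Sum.inl i) * X (Sum.inr (Sum.inr c))) := by
  simp [labelMap]

theorem X_inl_mem_labelIdeal {l : V → Option ℕ} {i : V} :
    X (Sum.inl i) ∈ labelIdeal K l ↔ l i = none := by
  rw [labelIdeal, RingHom.mem_ker, labelMap_inl]
  cases l i <;> simp [X_ne_zero]

theorem X_inr_mem_labelIdeal {l : V → Option ℕ} {i : V} :
    X (Sum.inr i) ∈ labelIdeal K l ↔ l i = none := by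
  rw [labelIdeal, RingHom.mem_ker, labelMap_inr]
  cases l i <;> simp [X_ne_zero]

theorem minor_mem_labelIdeal {l : V → Option ℕ} {i j : V} :
    minor K i j ∈ labelIdeal K l ↔ l i = none ∨ l j = none ∨ l i = l j := by
  rw [labelIdeal, RingHom.mem_ker, minor, map_sub, map_mul, map_mul, labelMap_inl, labelMap_inl,
    labelMap_inr, labelMap_inr]
  rcases hi : l i with _ | c <;> rcases hj : l j with _ | d
  · simp
  · simp
  · simp
  · simp only [Option.elim_some, reduceCtorEq, Option.some.injEq, false_or]
    have key : (X (Sum.inl i) * X (Sum.inr (Sum.inl c)) * (X (Sum.inl j) * X (Sum.inr (Sum.inr d)))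
        - X (Sum.inl j) * X (Sum.inr (Sum.inl d)) * (X (Sum.inl i) * X (Sum.inr (Sum.inr c))) :
          MvPolynomial (V ⊕ (ℕ ⊕ ℕ)) K) = X (Sum.inl i) * X (Sum.inl j) *
        (X (Sum.inr (Sum.inl c)) * X (Sum.inr (Sum.inr d))
          - X (Sum.inr (Sum.inl d)) * X (Sum.inr (Sum.inr c))) := by ring
    rw [key]
    constructor
    · intro h
      by_contra hcd
      rcases mul_eq_zero.1 h with h | h
      · exact (mul_ne_zero (X_ne_zero _) (X_ne_zero _)) h
      · have := congrArg (aeval (R := K) (S₁ := K) (Sum.elim (fun _ => 0)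
          (Sum.elim (fun x => if x = c then (1 : K) else 0) (fun x => if x = d then 1 else 0)))) h
        simp [hcd] at this
    · rintro rfl
      ring

theorem minor_mem_binomialEdgeIdeal {G : SimpleGraph V} {i j : V} (h : G.Adj i j) :
    minor K i j ∈ binomialEdgeIdeal K G :=
  Ideal.subset_span ⟨i, j, h, rfl⟩

theorem minor_symm_mem {I : Ideal (MvPolynomial (V ⊕ V) K)} {i j : V} (h : minor K i j ∈ I) :
    minor K j i ∈ I := by
  have : minor K j i = - minor K i j := by simp only [minor]; ring
  rw [this]
  exact I.neg_mem h

/-- Proportionality of columns is transitive through a nonzero column, by a Plücker-type identity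
multiplied by a nonvanishing entry of column $j$. -/
theorem minor_trans_mem {q : Ideal (MvPolynomial (V ⊕ V) K)} (hq : q.IsPrime) {i j k : V}
    (hij : minor K i j ∈ q) (hjk : minor K j k ∈ q)
    (hj : ¬ (X (Sum.inl j) ∈ q ∧ X (Sum.inr j) ∈ q)) : minor K i k ∈ q := by
  rw [not_and_or] at hj
  rcases hj with hj | hj
  · have : X (Sum.inl j) * minor K i k =
        X (Sum.inl k) * minor K i j + X (Sum.inl i) * minor K j k := by simp only [minor]; ring
    refine (hq.mem_or_mem (?_ : X (Sum.inl j) * minor K i k ∈ q)).resolve_left hj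
    rw [this]
    exact q.add_mem (q.mul_mem_left _ hij) (q.mul_mem_left _ hjk)
  · have : X (Sum.inr j) * minor K i k =
        X (Sum.inr k) * minor K i j + X (Sum.inr i) * minor K j k := by simp only [minor]; ring
    refine (hq.mem_or_mem (?_ : X (Sum.inr j) * minor K i k ∈ q)).resolve_left hj
    rw [this]
    exact q.add_mem (q.mul_mem_left _ hij) (q.mul_mem_left _ hjk)

/-- Over the fraction field of the quotient by $q$, vanishing minors make the columns of one label
multiples of a single vector. Hence the map to that field factors through `labelMap`, so it kills
`labelIdeal`. This avoids any computation of generators of the kernel. -/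
theorem labelIdeal_le {l : V → Option ℕ} {q : Ideal (MvPolynomial (V ⊕ V) K)} (hq : q.IsPrime)
    (hx : ∀ i, l i = none → X (Sum.inl i) ∈ q) (hy : ∀ i, l i = none → X (Sum.inr i) ∈ q)
    (hm : ∀ i j, l i = l j → l i ≠ none → minor K i j ∈ q) : labelIdeal K l ≤ q := by
  let F := FractionRing (MvPolynomial (V ⊕ V) K ⧸ q)
  let π : MvPolynomial (V ⊕ V) K →ₐ[K] F :=
    (Algebra.algHom K (MvPolynomial (V ⊕ V) K ⧸ q) F).comp (Ideal.Quotient.mkₐ K q)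
  have hπ : ∀ p, π p = 0 ↔ p ∈ q := by
    intro p
    change algebraMap (MvPolynomial (V ⊕ V) K ⧸ q) F (Ideal.Quotient.mk q p) = 0 ↔ _
    rw [FaithfulSMul.algebraMap_eq_zero_iff, Ideal.Quotient.eq_zero_iff_mem]
  have hcol : ∀ c : ℕ, ∃ ab : F × F, ∀ i, l i = some c →
      ∃ t, π (X (Sum.inl i)) = t * ab.1 ∧ π (X (Sum.inr i)) = t * ab.2 := by
    intro c
    -- A nonzero column with label $c$ serves as the common direction; if all of them vanish, the
    -- zero vector does.
    by_cases h : ∃ j, l j = some c ∧ (π (X (Sum.inl j)) ≠ 0 ∨ π (X (Sum.inr j)) ≠ 0)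
    · obtain ⟨j, hj, hne⟩ := h
      refine ⟨(π (X (Sum.inl j)), π (X (Sum.inr j))), fun i hi => ?_⟩
      have hmin := (hπ _).2 (hm i j (hi.trans hj.symm) (by simp [hi]))
      rw [minor, map_sub, map_mul, map_mul, sub_eq_zero] at hmin
      rcases hne with hne | hne
      · refine ⟨π (X (Sum.inl i)) / π (X (Sum.inl j)), (div_mul_cancel₀ _ hne).symm, ?_⟩
        rw [div_mul_eq_mul_div, eq_div_iff hne, hmin, mul_comm]
      · refine ⟨π (X (Sum.inr i)) / π (X (Sum.inr j)), ?_, (div_mul_cancel₀ _ hne).symm⟩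
        rw [div_mul_eq_mul_div, eq_div_iff hne, hmin, mul_comm]
    · push Not at h
      exact ⟨(0, 0), fun i hi => ⟨0, by simp [h i hi]⟩⟩
  choose ab hab using hcol
  have hex : ∀ i, ∃ t : F, ∀ c, l i = some c →
      π (X (Sum.inl i)) = t * (ab c).1 ∧ π (X (Sum.inr i)) = t * (ab c).2 := by
    intro i
    rcases hi : l i with _ | c
    · exact ⟨0, by simp⟩
    · obtain ⟨t, ht⟩ := hab c i hi
      exact ⟨t, fun d hd => by cases hd; exact ht⟩
  choose t ht using hex
  let ψ : MvPolynomial (V ⊕ (ℕ ⊕ ℕ)) K →ₐ[K] F :=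
    aeval (Sum.elim t (Sum.elim (fun c => (ab c).1) (fun c => (ab c).2)))
  have hψ : ψ.comp (labelMap K l) = π := by
    apply MvPolynomial.algHom_ext
    rintro (i | i)
    · rw [AlgHom.comp_apply, labelMap_inl]
      rcases hi : l i with _ | c
      · simp [(hπ _).2 (hx i hi)]
      · simp [ψ, (ht i c hi).1]
    · rw [AlgHom.comp_apply, labelMap_inr]
      rcases hi : l i with _ | c
      · simp [(hπ _).2 (hy i hi)]
      · simp [ψ, (ht i c hi).2]
  intro p hp
  rw [← hπ, ← hψ, AlgHom.comp_apply]
  rw [labelIdeal, RingHom.mem_ker] at hp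
  rw [hp, map_zero]

theorem labelIdeal_le_labelIdeal {l m : V → Option ℕ} (h0 : ∀ i, l i = none → m i = none)
    (h1 : ∀ i j, l i = l j → m i = none ∨ m j = none ∨ m i = m j) :
    labelIdeal K l ≤ labelIdeal K m :=
  labelIdeal_le inferInstance (fun i hi => X_inl_mem_labelIdeal.2 (h0 i hi))
    (fun i hi => X_inr_mem_labelIdeal.2 (h0 i hi))
    (fun i j hij _ => minor_mem_labelIdeal.2 (h1 i j hij))

end LabelIdeals

/-! ### The height of a label ideal -/

section Height

variable {K : Type v} [Field K] {V : Type u}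

/-- The vertices without label. -/
def blank (l : V → Option ℕ) : Set V := {i | l i = none}

/-- The labels that occur. -/
def labels (l : V → Option ℕ) : Set ℕ := {c | ∃ i, l i = some c}

theorem labels_finite [Finite V] (l : V → Option ℕ) : (labels l).Finite := by
  refine ((Set.finite_range l).preimage (Option.some_injective ℕ).injOn).subset ?_
  rintro c ⟨i, hi⟩
  exact ⟨i, hi⟩

/-- One vertex for each label that occurs. -/
theorem exists_transversal (l : V → Option ℕ) : ∃ r : V → V, (∀ i, l (r i) = l i) ∧
    (∀ i j, l i = l j → r i = r j) := by
  classical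
  rcases isEmpty_or_nonempty V with h | h
  · exact ⟨id, fun i => (h.false i).elim, fun i => (h.false i).elim⟩
  · refine ⟨fun i => Function.invFun l (l i), fun i => ?_, fun i j h => by simp only [h]⟩
    exact Function.invFun_eq ⟨i, rfl⟩

theorem ncard_transversal {l : V → Option ℕ} {r : V → V} (hr : ∀ i, l (r i) = l i)
    (hr' : ∀ i j, l i = l j → r i = r j) :
    {i | l i ≠ none ∧ r i = i}.ncard = (labels l).ncard := by
  refine Set.ncard_congr (fun i _ => (l i).getD 0) ?_ ?_ ?_
  · rintro i ⟨hi, -⟩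
    obtain ⟨c, hc⟩ := Option.ne_none_iff_exists'.1 hi
    exact ⟨i, by simp [hc]⟩
  · rintro i j ⟨hi, hi'⟩ ⟨hj, hj'⟩ h
    obtain ⟨c, hc⟩ := Option.ne_none_iff_exists'.1 hi
    obtain ⟨d, hd⟩ := Option.ne_none_iff_exists'.1 hj
    rw [← hi', ← hj']
    apply hr'
    simp_all
  · rintro c ⟨i, hi⟩
    refine ⟨r i, ⟨by simp [hr, hi], hr' _ _ (hr i)⟩, by simp [hr, hi]⟩

theorem blank_add_labels_le [Finite V] (l : V → Option ℕ) :
    (blank l).ncard + (labels l).ncard ≤ Nat.card V := by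
  obtain ⟨r, hr, hr'⟩ := exists_transversal l
  rw [← ncard_transversal hr hr', ← Set.ncard_union_eq]
  · exact Set.ncard_le_card _
  · rw [Set.disjoint_left]
    intro i hi h
    exact h.1 hi

/-- Krull's height theorem: the ideal is minimal over two variables per blank vertex and one minor
per labelled vertex that is not the representative of its label. -/
theorem labelIdeal_height_le [Finite V] (l : V → Option ℕ) {h : ℕ}
    (hh : h + (labels l).ncard = (blank l).ncard + Nat.card V) : (labelIdeal K l).height ≤ h := by
  classical
  obtain ⟨r, hr, hr'⟩ := exists_transversal l
  let W : Set V := {i | l i ≠ none ∧ r i ≠ i}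
  let s : Set (MvPolynomial (V ⊕ V) K) := ((fun i => X (Sum.inl i)) '' blank l ∪
    (fun i => X (Sum.inr i)) '' blank l) ∪ (fun i => minor K (r i) i) '' W
  have hmin : labelIdeal K l ∈ (Ideal.span s).minimalPrimes := by
    refine ⟨⟨inferInstance, ?_⟩, ?_⟩
    · rw [Ideal.span_le]
      rintro f ((⟨i, hi, rfl⟩ | ⟨i, hi, rfl⟩) | ⟨i, hi, rfl⟩)
      · exact X_inl_mem_labelIdeal.2 hi
      · exact X_inr_mem_labelIdeal.2 hi
      · exact minor_mem_labelIdeal.2 (Or.inr (Or.inr (hr i)))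
    · rintro q ⟨hq, hsq⟩ hqP
      rw [Ideal.span_le] at hsq
      have hrm : ∀ i, l i ≠ none → minor K (r i) i ∈ q := by
        intro i hi
        by_cases hri : r i = i
        · rw [hri]
          simp [minor]
        · exact hsq (Or.inr ⟨i, ⟨hi, hri⟩, rfl⟩)
      refine labelIdeal_le hq (fun i hi => hsq (Or.inl (Or.inl ⟨i, hi, rfl⟩)))
        (fun i hi => hsq (Or.inl (Or.inr ⟨i, hi, rfl⟩))) (fun i j hij hi => ?_)
      -- Transitivity passes through the representative, whose column is nonzero modulo $q$ because
      -- $q$ lies in the label ideal.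
      refine minor_trans_mem hq (minor_symm_mem (hrm i hi)) (hr' i j hij ▸ hrm j (hij ▸ hi)) ?_
      rintro ⟨h1, -⟩
      have := X_inl_mem_labelIdeal.1 (hqP h1)
      rw [hr i] at this
      exact hi this
  have hsfin : s.Finite :=
    (((Set.toFinite _).image _).union ((Set.toFinite _).image _)).union ((Set.toFinite _).image _)
  refine (Ideal.height_le_card_of_mem_minimalPrimes_span hsfin hmin).trans ?_
  have h1 : s.ncard ≤ ((blank l).ncard + (blank l).ncard) + W.ncard :=
    (Set.ncard_union_le _ _).trans (add_le_add ((Set.ncard_union_le _ _).trans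
      (add_le_add (Set.ncard_image_le (Set.toFinite _)) (Set.ncard_image_le (Set.toFinite _))))
      (Set.ncard_image_le (Set.toFinite _)))
  have h2 : (blank l).ncard + ((labels l).ncard + W.ncard) = Nat.card V := by
    rw [← ncard_transversal hr hr', ← Set.ncard_univ, ← Set.ncard_union_eq, ← Set.ncard_union_eq]
    · congr 1
      ext i
      simp only [Set.mem_union, Set.mem_ofPred_eq, blank, W, Set.mem_univ, iff_true]
      tauto
    · rw [Set.disjoint_left]
      rintro i hi (h | h)
      exacts [h.1 hi, h.1 hi]
    · rw [Set.disjoint_left]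
      rintro i hi h
      exact h.2 hi.2
  have h3 : s.ncard ≤ h := by omega
  exact_mod_cast h3

theorem height_succ_le {R : Type*} [CommRing R] {p q : Ideal R} [p.IsPrime] [q.IsPrime] {k : ℕ}
    (hpq : p ≤ q) (hne : ¬ q ≤ p) (hk : (k : ℕ∞) ≤ p.height) : ((k + 1 : ℕ) : ℕ∞) ≤ q.height := by
  have := Ideal.height_add_one_le_of_lt_of_isPrime (lt_of_le_not_ge hpq hne)
  push_cast
  exact (add_le_add_left hk 1).trans this

-- A descending chain of primes is built by relabelling one vertex at a time: split a repeated
-- label, or give a blank vertex a label already in use. Each move lowers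
-- $|\mathrm{blank}|+|V|-|\mathrm{labels}|$ by one. When no label is in use, labelling a vertex
-- lowers it by two, and an extra prime is inserted.
open Classical in
theorem le_labelIdeal_height [Finite V] (k : ℕ) : ∀ (l : V → Option ℕ),
    (k + (labels l).ncard = (blank l).ncard + Nat.card V) → (k : ℕ∞) ≤ (labelIdeal K l).height := by
  induction k using Nat.strong_induction_on with
  | _ k ih =>
  intro l hk
  rcases Nat.eq_zero_or_pos k with rfl | hpos
  · simp
  rcases (blank l).eq_empty_or_nonempty with hb | ⟨s, hs⟩
  · obtain ⟨i, j, hij, hne⟩ : ∃ i j, l i = l j ∧ i ≠ j := by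
      by_contra hcon
      push Not at hcon
      have : Nat.card V ≤ (labels l).ncard := by
        rw [← Set.ncard_univ]
        refine Set.ncard_le_ncard_of_injOn (fun i => (l i).getD 0) ?_ ?_ (labels_finite l)
        · intro i _
          have hi : l i ≠ none := fun h => (hb ▸ h : i ∈ (∅ : Set V))
          obtain ⟨c, hc⟩ := Option.ne_none_iff_exists'.1 hi
          exact ⟨i, by simp [hc]⟩
        · intro i _ j _ h
          have hi : l i ≠ none := fun h => (hb ▸ h : i ∈ (∅ : Set V))
          have hj : l j ≠ none := fun h => (hb ▸ h : j ∈ (∅ : Set V))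
          obtain ⟨c, hc⟩ := Option.ne_none_iff_exists'.1 hi
          obtain ⟨d, hd⟩ := Option.ne_none_iff_exists'.1 hj
          by_contra hne
          exact hne (hcon i j (by simp_all))
      rw [hb] at hk
      simp at hk
      omega
    -- With no blank vertex, $i$ moves to a fresh label while $j$ keeps the old one alive.
    obtain ⟨c, hc⟩ := (labels_finite l).exists_notMem
    have hc' : ∀ a, l a ≠ some c := fun a ha => hc ⟨a, ha⟩
    let m := Function.update l i (some c)
    have hmi : m i = some c := by simp [m]
    have hmo : ∀ a, a ≠ i → m a = l a := fun a ha => by simp [m, ha]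
    have hlab : labels m = insert c (labels l) := by
      ext d
      constructor
      · rintro ⟨a, ha⟩
        by_cases hai : a = i
        · subst hai
          rw [hmi] at ha
          exact Or.inl (Option.some.inj ha).symm
        · exact Or.inr ⟨a, by rw [← hmo a hai, ha]⟩
      · rintro (rfl | ⟨a, ha⟩)
        · exact ⟨i, hmi⟩
        · by_cases hai : a = i
          · exact ⟨j, by rw [hmo j hne.symm, ← hij, ← hai, ha]⟩
          · exact ⟨a, by rw [hmo a hai, ha]⟩
    have hbl : blank m = ∅ := by
      rw [Set.eq_empty_iff_forall_notMem] at hb ⊢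
      intro a (ha : m a = none)
      by_cases hai : a = i
      · subst hai
        rw [hmi] at ha
        cases ha
      · exact hb a (by rw [hmo a hai] at ha; exact ha)
    have hcard : (labels m).ncard = (labels l).ncard + 1 := by
      rw [hlab, Set.ncard_insert_of_notMem hc (labels_finite l)]
    have hm := ih (k - 1) (by omega) m (by rw [hbl, hcard, ← hb]; omega)
    have := height_succ_le (q := labelIdeal K l) ?_ ?_ hm
    · rwa [Nat.sub_add_cancel hpos] at this
    · refine labelIdeal_le_labelIdeal (fun a ha => ?_) (fun a b hab => ?_)
      · exact (Set.eq_empty_iff_forall_notMem.1 hbl a ha).elim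
      · by_cases hai : a = i <;> by_cases hbi : b = i
        · simp [hai, hbi]
        · rw [hai, hmi] at hab
          rw [hmo b hbi] at hab
          exact (hc' b hab.symm).elim
        · rw [hbi, hmi] at hab
          rw [hmo a hai] at hab
          exact (hc' a hab).elim
        · rw [hmo a hai, hmo b hbi] at hab
          exact Or.inr (Or.inr hab)
    · intro hle
      have h1 : minor K i j ∈ labelIdeal K l := minor_mem_labelIdeal.2 (Or.inr (Or.inr hij))
      rcases minor_mem_labelIdeal.1 (hle h1) with h | h | h
      · rw [hmi] at h; cases h
      · exact Set.eq_empty_iff_forall_notMem.1 hbl j h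
      · rw [hmi, hmo j hne.symm] at h
        exact hc' j h.symm
  · have hbs : ∀ c, blank (Function.update l s (some c)) = blank l \ {s} := by
      intro c
      ext a
      by_cases has : a = s
      · subst has
        simp [blank]
      · simp [blank, has]
    have hbcard : (blank l \ {s}).ncard + 1 = (blank l).ncard :=
      Set.ncard_sdiff_singleton_add_one hs (Set.toFinite _)
    have hsub : ∀ c, labelIdeal K (Function.update l s (some c)) ≤ labelIdeal K l := by
      intro c
      refine labelIdeal_le_labelIdeal (fun a ha => ?_) (fun a b hab => ?_)
      · have : a ∈ blank l \ {s} := hbs c ▸ ha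
        exact this.1
      · by_cases hai : a = s
        · exact Or.inl (hai ▸ hs)
        · by_cases hbi : b = s
          · exact Or.inr (Or.inl (hbi ▸ hs))
          · simp only [Function.update_of_ne hai, Function.update_of_ne hbi] at hab
            exact Or.inr (Or.inr hab)
    have hs' : l s = none := hs
    rcases (labels l).eq_empty_or_nonempty with hl | ⟨c, hc⟩
    · have hall : ∀ a, l a = none := by
        intro a
        by_contra ha
        obtain ⟨c, hc⟩ := Option.ne_none_iff_exists'.1 ha
        exact Set.eq_empty_iff_forall_notMem.1 hl c ⟨a, hc⟩
      let m := Function.update l s (some 0)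
      have hlab : labels m = {0} := by
        ext d
        constructor
        · rintro ⟨a, ha⟩
          by_cases has : a = s
          · subst has
            simpa [m, eq_comm] using ha
          · simp [m, has, hall] at ha
        · rintro rfl
          exact ⟨s, by simp [m]⟩
      have hVpos : 0 < Nat.card V := @Nat.card_pos V ⟨s⟩ _
      have hm := ih (k - 2) (by omega) m (by
        rw [hbs, hlab, Set.ncard_singleton]
        rw [hl, Set.ncard_empty] at hk
        omega)
      -- The intermediate prime: every variable except $x_s$ vanishes. It lies strictly between the
      -- ideal where only column $s$ is free and the ideal where all columns are zero.
      let q : Ideal (MvPolynomial (V ⊕ V) K) := RingHom.ker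
        (aeval (Sum.elim (fun a => if a = s then Polynomial.X else 0) (fun _ => 0)) :
          MvPolynomial (V ⊕ V) K →ₐ[K] Polynomial K)
      have hqx : ∀ a, X (Sum.inl a) ∈ q ↔ a ≠ s := by
        intro a
        rw [RingHom.mem_ker, aeval_X]
        by_cases has : a = s <;> simp [has]
      have hqy : ∀ a, X (Sum.inr a) ∈ q := by
        intro a
        rw [RingHom.mem_ker, aeval_X]
        simp
      have : q.IsPrime := RingHom.ker_isPrime _
      have h1 := height_succ_le (q := q) ?_ ?_ hm
      have h2 := height_succ_le (q := labelIdeal K l) ?_ ?_ h1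
      · rw [hl, Set.ncard_empty] at hk
        have : k - 2 + 1 + 1 = k := by omega
        rwa [this] at h2
      · intro f hf
        rw [labelIdeal, RingHom.mem_ker]
        -- As no vertex is labelled, `labelMap` sends all variables to zero and so factors through
        -- the quotient by $q$.
        have h0 : labelMap K l = (Polynomial.aeval (0 : MvPolynomial (V ⊕ (ℕ ⊕ ℕ)) K)).comp
          (aeval (Sum.elim (fun a => if a = s then Polynomial.X else 0) (fun _ => 0))) := by
          apply MvPolynomial.algHom_ext
          rintro (a | a)
          · rw [labelMap_inl, hall]
            by_cases has : a = s <;> simp [has]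
          · rw [labelMap_inr, hall]
            simp
        rw [h0, AlgHom.comp_apply]
        rw [RingHom.mem_ker] at hf
        rw [hf, map_zero]
      · intro hle
        exact (hqx s).1 (hle (X_inl_mem_labelIdeal.2 hs)) rfl
      · refine labelIdeal_le inferInstance (fun a ha => ?_) (fun a _ => hqy a) (fun a b _ _ => ?_)
        · rw [hqx]
          rintro rfl
          simp [m] at ha
        · exact q.sub_mem (q.mul_mem_left _ (hqy b)) (q.mul_mem_left _ (hqy a))
      · intro hle
        have := X_inr_mem_labelIdeal.1 (hle (hqy s))
        simp [m] at this
    · let m := Function.update l s (some c)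
      have hlab : labels m = labels l := by
        ext d
        constructor
        · rintro ⟨a, ha⟩
          by_cases has : a = s
          · subst has
            have : c = d := by simpa [m] using ha
            exact this ▸ hc
          · exact ⟨a, by simpa [m, has] using ha⟩
        · rintro ⟨a, ha⟩
          have has : a ≠ s := by
            rintro rfl
            rw [hs'] at ha
            cases ha
          exact ⟨a, by simpa [m, has] using ha⟩
      have hm := ih (k - 1) (by omega) m (by rw [hbs, hlab]; omega)
      have := height_succ_le (q := labelIdeal K l) (hsub c) ?_ hm
      · rwa [Nat.sub_add_cancel hpos] at this
      · intro hle
        have := X_inl_mem_labelIdeal.1 (hle (X_inl_mem_labelIdeal.2 hs'))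
        simp at this

theorem labelIdeal_height [Finite V] (l : V → Option ℕ) {h : ℕ}
    (hh : h + (labels l).ncard = (blank l).ncard + Nat.card V) : (labelIdeal K l).height = h :=
  le_antisymm (labelIdeal_height_le l hh) (le_labelIdeal_height h l hh)

end Height

/-! ### Connectivity in the complement of a vertex set, and cut sets -/

section Components

variable {V : Type u} {W : Type w}

/-- `x` and `y` lie outside `S` and are connected in the complement of `S`. -/
def Conn (G : SimpleGraph V) (S : Set V) (x y : V) : Prop :=
  ∃ (hx : x ∉ S) (hy : y ∉ S), (G.induce Sᶜ).Reachable ⟨x, hx⟩ ⟨y, hy⟩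

variable {G : SimpleGraph V} {H : SimpleGraph W} {S T : Set V} {R : Set W} {x y z : V}

theorem Conn.left (h : Conn G S x y) : x ∉ S := h.1

theorem Conn.right (h : Conn G S x y) : y ∉ S := h.2.1

theorem Conn.refl (hx : x ∉ S) : Conn G S x x := ⟨hx, hx, SimpleGraph.Reachable.refl _⟩

theorem Conn.symm (h : Conn G S x y) : Conn G S y x := ⟨h.2.1, h.1, h.2.2.symm⟩

theorem Conn.trans (h : Conn G S x y) (h' : Conn G S y z) : Conn G S x z :=
  ⟨h.1, h'.2.1, h.2.2.trans h'.2.2⟩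

theorem Conn.of_adj (hx : x ∉ S) (hy : y ∉ S) (h : G.Adj x y) : Conn G S x y :=
  ⟨hx, hy, SimpleGraph.Adj.reachable (by simpa using h)⟩

theorem Conn.induct (h : Conn G S x y) {p : V → Prop} (h0 : p x)
    (hs : ∀ a b, Conn G S x a → b ∉ S → G.Adj a b → p a → p b) : p y := by
  obtain ⟨hx, hy, hr⟩ := h
  rw [SimpleGraph.reachable_iff_reflTransGen] at hr
  suffices ∀ w : ↥Sᶜ, Relation.ReflTransGen (G.induce Sᶜ).Adj ⟨x, hx⟩ w → p w from this ⟨y, hy⟩ hr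
  intro w hw
  induction hw with
  | refl => exact h0
  | @tail b c hb hbc ih =>
    exact hs b c ⟨hx, b.2, (SimpleGraph.reachable_iff_reflTransGen _ _).2 hb⟩ c.2
      (by simpa using hbc) ih

theorem Conn.map {f : V → W} (h : Conn G S x y) (hf : ∀ a, a ∉ S → f a ∉ R)
    (hadj : ∀ a b, a ∉ S → b ∉ S → G.Adj a b → f a = f b ∨ Conn H R (f a) (f b)) :
    Conn H R (f x) (f y) := by
  refine h.induct (p := fun w => Conn H R (f x) (f w)) (Conn.refl (hf _ h.left)) ?_
  intro a b ha hb hab ih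
  rcases hadj a b ha.right hb hab with he | he
  · rwa [← he]
  · exact ih.trans he

theorem Conn.mono (h : Conn G S x y) (hTS : T ⊆ S) : Conn G T x y :=
  h.map (f := id) (fun _ ha => fun h => ha (hTS h))
    (fun _ _ ha hb hab => Or.inr (Conn.of_adj (fun h => ha (hTS h)) (fun h => hb (hTS h)) hab))

theorem Conn.mem_of_closed {X : Set V} (h : Conn G S x y) (hx : x ∈ X)
    (hX : ∀ a b, a ∈ X → a ∉ S → b ∉ S → G.Adj a b → b ∈ X) : y ∈ X :=
  h.induct (p := fun w => w ∈ X) hx (fun a b ha hb hab h => hX a b h ha.right hb hab)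

theorem Conn.of_subset {X : Set V} (h : Conn G S x y) (hx : x ∈ X)
    (hX : ∀ a b, a ∈ X → a ∉ S → b ∉ S → G.Adj a b → b ∈ X)
    (hT : ∀ a ∈ X, a ∉ S → a ∉ T) : Conn G T x y := by
  refine (h.induct (p := fun w => w ∈ X ∧ Conn G T x w) ⟨hx, Conn.refl (hT _ hx h.left)⟩ ?_).2
  intro a b ha hb hab ⟨haX, hc⟩
  have hbX := hX a b haX ha.right hb hab
  exact ⟨hbX, hc.trans (Conn.of_adj hc.right (hT _ hbX hb) hab)⟩

/-- Each passage of a walk through $i$ enters and leaves by neighbours of $i$ outside $S$, and `hn`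
supplies a detour between them. -/
theorem Conn.of_diff_singleton {i : V} (h : Conn G (S \ {i}) x y) (hx : x ∉ S) (hy : y ∉ S)
    (hi : i ∈ S) (hn : ∀ a b, a ∉ S → b ∉ S → G.Adj i a → G.Adj i b → Conn G S a b) :
    Conn G S x y := by
  -- While the walk stands at $i$, the induction remembers a neighbour of $i$ already reached
  -- outside $S$.
  have key := h.induct (p := fun w => (w ≠ i → Conn G S x w) ∧
    (w = i → ∃ b, G.Adj i b ∧ Conn G S x b)) ⟨fun _ => Conn.refl hx, fun hxi => ?_⟩ ?_
  · exact key.1 (by rintro rfl; exact hy hi)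
  · subst hxi
    exact (hx hi).elim
  · intro a b ha hb hab ⟨h1, h2⟩
    have hbS : b ≠ i → b ∉ S := fun hbi hbS => hb ⟨hbS, hbi⟩
    constructor
    · intro hbi
      by_cases hai : a = i
      · subst hai
        obtain ⟨c, hc, hxc⟩ := h2 rfl
        exact hxc.trans (hn c b hxc.right (hbS hbi) hc hab)
      · exact (h1 hai).trans (Conn.of_adj (h1 hai).right (hbS hbi) hab)
    · rintro rfl
      exact ⟨a, hab.symm, h1 (G.ne_of_adj hab)⟩

theorem conn_iff_mk_eq (hx : x ∉ S) (hy : y ∉ S) : Conn G S x y ↔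
    (G.induce Sᶜ).connectedComponentMk ⟨x, hx⟩ = (G.induce Sᶜ).connectedComponentMk ⟨y, hy⟩ := by
  rw [SimpleGraph.ConnectedComponent.eq]
  exact ⟨fun h => h.2.2, fun h => ⟨hx, hy, h⟩⟩

/-- The component of `x` in the complement of `S`. -/
def part (G : SimpleGraph V) (S : Set V) (x : V) : Set V := {y | Conn G S x y}

theorem part_eq_part (hx : x ∉ S) : part G S x = part G S y ↔ Conn G S x y := by
  constructor
  · intro h
    have : x ∈ part G S x := Conn.refl hx
    rw [h] at this
    exact Conn.symm this
  · intro h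
    ext w
    exact ⟨fun hw => h.symm.trans hw, fun hw => h.trans hw⟩

theorem compCount_eq_ncard (G : SimpleGraph V) (S : Set V) :
    compCount G S = (part G S '' Sᶜ).ncard := by
  rw [compCount, ← Set.ncard_univ]
  refine Set.ncard_congr (fun c _ => part G S c.out.1) ?_ ?_ ?_
  · intro c _
    exact ⟨_, c.out.2, rfl⟩
  · intro c d _ _ h
    rw [part_eq_part c.out.2, conn_iff_mk_eq c.out.2 d.out.2] at h
    have hc : (G.induce Sᶜ).connectedComponentMk c.out = c := Quot.out_eq c
    have hd : (G.induce Sᶜ).connectedComponentMk d.out = d := Quot.out_eq d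
    rw [← hc, ← hd]
    exact h
  · rintro _ ⟨x, hx, rfl⟩
    refine ⟨(G.induce Sᶜ).connectedComponentMk ⟨x, hx⟩, trivial, ?_⟩
    have hS := ((G.induce Sᶜ).connectedComponentMk ⟨x, hx⟩).out.2
    rw [part_eq_part hS, conn_iff_mk_eq hS hx]
    exact Quot.out_eq _

theorem exists_labelling [Finite V] (G : SimpleGraph V) (S : Set V) : ∃ l : V → Option ℕ,
    blank l = S ∧ (∀ x y, x ∉ S → y ∉ S → (l x = l y ↔ Conn G S x y)) ∧
    (labels l).ncard = compCount G S := by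
  classical
  obtain ⟨e, he⟩ := exists_injective_nat (G.induce Sᶜ).ConnectedComponent
  let l : V → Option ℕ := fun x =>
    if h : x ∈ S then none else some (e ((G.induce Sᶜ).connectedComponentMk ⟨x, h⟩))
  refine ⟨l, ?_, ?_, ?_⟩
  · ext x
    by_cases h : x ∈ S <;> simp [blank, l, h]
  · intro x y hx hy
    rw [conn_iff_mk_eq hx hy]
    simp [l, hx, hy, he.eq_iff]
  · have : labels l = Set.range e := by
      ext c
      constructor
      · rintro ⟨x, hx⟩
        by_cases h : x ∈ S
        · simp [l, h] at hx
        · simp only [l, h, dite_false, Option.some.injEq] at hx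
          exact ⟨_, hx⟩
      · rintro ⟨C, rfl⟩
        induction C using SimpleGraph.ConnectedComponent.ind with
        | _ v => exact ⟨v, by simp [l, show v.1 ∉ S from v.2]⟩
    rw [this, ← Set.image_univ, Set.ncard_image_of_injective _ he, Set.ncard_univ, compCount]

theorem compCount_le [Finite W] (f : V → W) (hf : ∀ x, x ∉ S → f x ∉ R)
    (hinj : ∀ x y, x ∉ S → y ∉ S → Conn H R (f x) (f y) → Conn G S x y) :
    compCount G S ≤ compCount H R := by
  refine Nat.card_le_card_of_injective
    (fun c => (H.induce Rᶜ).connectedComponentMk ⟨f c.out.1, hf _ c.out.2⟩) ?_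
  intro c d h
  have h1 := hinj _ _ c.out.2 d.out.2 ((conn_iff_mk_eq (hf _ c.out.2) (hf _ d.out.2)).2 h)
  rw [conn_iff_mk_eq c.out.2 d.out.2] at h1
  have hc : (G.induce Sᶜ).connectedComponentMk c.out = c := Quot.out_eq c
  have hd : (G.induce Sᶜ).connectedComponentMk d.out = d := Quot.out_eq d
  rw [← hc, ← hd]
  exact h1

theorem compCount_lt [Finite V] [Finite W] (f : V → W) (hf : ∀ x, x ∉ S → f x ∉ R)
    (hinj : ∀ x y, x ∉ S → y ∉ S → Conn H R (f x) (f y) → Conn G S x y)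
    {b : W} (hb : b ∉ R) (hnb : ∀ x, x ∉ S → ¬ Conn H R (f x) b) :
    compCount G S < compCount H R := by
  have := Fintype.ofFinite (G.induce Sᶜ).ConnectedComponent
  have := Fintype.ofFinite (H.induce Rᶜ).ConnectedComponent
  rw [compCount, compCount, Nat.card_eq_fintype_card, Nat.card_eq_fintype_card]
  refine Fintype.card_lt_of_injective_of_notMem
    (fun c => (H.induce Rᶜ).connectedComponentMk ⟨f c.out.1, hf _ c.out.2⟩) ?_
    (b := (H.induce Rᶜ).connectedComponentMk ⟨b, hb⟩) ?_
  · intro c d h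
    have h1 := hinj _ _ c.out.2 d.out.2 ((conn_iff_mk_eq (hf _ c.out.2) (hf _ d.out.2)).2 h)
    rw [conn_iff_mk_eq c.out.2 d.out.2] at h1
    have hc : (G.induce Sᶜ).connectedComponentMk c.out = c := Quot.out_eq c
    have hd : (G.induce Sᶜ).connectedComponentMk d.out = d := Quot.out_eq d
    rw [← hc, ← hd]
    exact h1
  · rintro ⟨c, hc⟩
    exact hnb _ c.out.2 ((conn_iff_mk_eq (hf _ c.out.2) hb).2 hc)

/-- Restoring $i$ lowers the number of components exactly when it joins two of them. This local form
is the one used everywhere below. -/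
theorem isCutSet_iff [Finite V] : IsCutSet G S ↔
    ∀ i ∈ S, ∃ a b, a ∉ S ∧ b ∉ S ∧ G.Adj i a ∧ G.Adj i b ∧ ¬ Conn G S a b := by
  classical
  refine forall₂_congr fun i hi => ?_
  constructor
  · intro h
    by_contra hcon
    push Not at hcon
    refine h.not_ge (compCount_le id (fun x hx hx' => hx hx'.1) ?_)
    intro x y hx hy hxy
    exact hxy.of_diff_singleton hx hy hi hcon
  · rintro ⟨a, b, ha, hb, hia, hib, hab⟩
    have hi' : i ∉ S \ {i} := fun h => h.2 rfl
    have hia' : Conn G (S \ {i}) i a := Conn.of_adj hi' (fun h => ha h.1) hia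
    have hib' : Conn G (S \ {i}) i b := Conn.of_adj hi' (fun h => hb h.1) hib
    -- Choosing $a$ for the component that contains $i$ injects the components after restoring $i$
    -- into those before; the component of $b$ is missed.
    let f : V → V := fun x => if Conn G (S \ {i}) x i then a else x
    have hfc : ∀ x, x ∉ S \ {i} → Conn G (S \ {i}) x (f x) := by
      intro x hx
      by_cases h : Conn G (S \ {i}) x i
      · simp only [f, h, if_true]
        exact h.trans hia'
      · simp only [f, h, if_false]
        exact Conn.refl hx
    refine compCount_lt f (fun x hx => ?_) (fun x y hx hy h => ?_) hb (fun x hx h => ?_)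
    · by_cases h : Conn G (S \ {i}) x i
      · simp only [f, h, if_true]
        exact ha
      · simp only [f, h, if_false]
        intro hxS
        by_cases hxi : x = i
        · exact h (by rw [hxi]; exact Conn.refl hi')
        · exact hx ⟨hxS, hxi⟩
    · exact (hfc x hx).trans ((h.mono Set.sdiff_subset).trans (hfc y hy).symm)
    · by_cases h' : Conn G (S \ {i}) x i
      · simp only [f, h', if_true] at h
        exact hab h
      · simp only [f, h', if_false] at h
        exact h' ((h.mono Set.sdiff_subset).trans hib'.symm)

theorem isCutSet_empty (G : SimpleGraph V) : IsCutSet G ∅ := fun _ h => h.elim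

theorem conn_empty_iff : Conn G ∅ x y ↔ G.Reachable x y := by
  constructor
  · intro h
    exact h.induct (p := G.Reachable x) (SimpleGraph.Reachable.refl _)
      (fun a b _ _ hab h => h.trans hab.reachable)
  · intro h
    rw [SimpleGraph.reachable_iff_reflTransGen] at h
    induction h with
    | refl => exact Conn.refl (by simp)
    | tail _ hab ih => exact ih.trans (Conn.of_adj (by simp) (by simp) hab)

theorem compCount_empty [Finite V] (h : G.Connected) : compCount G ∅ = 1 := by
  rw [compCount_eq_ncard, Set.ncard_eq_one]
  obtain ⟨x⟩ := h.nonempty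
  refine ⟨part G ∅ x, ?_⟩
  ext C
  constructor
  · rintro ⟨y, -, rfl⟩
    exact (part_eq_part (by simp)).2 (conn_empty_iff.2 (h.preconnected y x))
  · rintro rfl
    exact ⟨x, by simp, rfl⟩

theorem compCount_eq_of_indep [Finite V] (h : ∀ a b, a ∉ S → b ∉ S → ¬ G.Adj a b) :
    compCount G S = Sᶜ.ncard := by
  rw [compCount_eq_ncard]
  refine Set.InjOn.ncard_image fun x hx y hy hxy => ?_
  refine ((part_eq_part hx).1 hxy).mem_of_closed (X := {w | x = w}) rfl ?_
  intro a b _ ha hb hab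
  exact (h a b ha hb hab).elim

theorem compCount_lt_ncard [Finite V] (hxy : Conn G S x y) (hne : x ≠ y) :
    compCount G S < Sᶜ.ncard := by
  rw [compCount_eq_ncard]
  refine lt_of_le_of_ne (Set.ncard_image_le (Set.toFinite _)) fun h => hne ?_
  exact Set.injOn_of_ncard_image_eq h (Set.toFinite _) hxy.left hxy.right
    ((part_eq_part hxy.left).2 hxy)

end Components

/-! ### Minimal primes of the binomial edge ideal and the combinatorial form of unmixedness -/

section MinimalPrimes

variable {K : Type v} [Field K] {V : Type u} [Finite V] {G : SimpleGraph V} {S T : Set V}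

/-- A labelling of the components of the complement of `S`. -/
noncomputable def compLabel (G : SimpleGraph V) (S : Set V) : V → Option ℕ :=
  (exists_labelling G S).choose

theorem blank_compLabel (G : SimpleGraph V) (S : Set V) : blank (compLabel G S) = S :=
  (exists_labelling G S).choose_spec.1

theorem compLabel_eq_none {i : V} : compLabel G S i = none ↔ i ∈ S :=
  Set.ext_iff.1 (blank_compLabel G S) i

theorem compLabel_eq_iff {x y : V} (hx : x ∉ S) (hy : y ∉ S) :
    compLabel G S x = compLabel G S y ↔ Conn G S x y :=
  (exists_labelling G S).choose_spec.2.1 x y hx hy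

theorem ncard_labels_compLabel (G : SimpleGraph V) (S : Set V) :
    (labels (compLabel G S)).ncard = compCount G S :=
  (exists_labelling G S).choose_spec.2.2

variable (K G S) in
/-- The prime ideal of the binomial edge ideal attached to a set of vertices. -/
noncomputable def cutIdeal : Ideal (MvPolynomial (V ⊕ V) K) := labelIdeal K (compLabel G S)

instance : (cutIdeal K G S).IsPrime := labelIdeal_isPrime K _

theorem X_inl_mem_cutIdeal {i : V} : X (Sum.inl i) ∈ cutIdeal K G S ↔ i ∈ S :=
  X_inl_mem_labelIdeal.trans compLabel_eq_none

theorem X_inr_mem_cutIdeal {i : V} : X (Sum.inr i) ∈ cutIdeal K G S ↔ i ∈ S :=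
  X_inr_mem_labelIdeal.trans compLabel_eq_none

theorem minor_mem_cutIdeal {i j : V} :
    minor K i j ∈ cutIdeal K G S ↔ i ∈ S ∨ j ∈ S ∨ Conn G S i j := by
  rw [cutIdeal, minor_mem_labelIdeal, compLabel_eq_none, compLabel_eq_none]
  by_cases hi : i ∈ S
  · simp [hi]
  · by_cases hj : j ∈ S
    · simp [hj]
    · rw [compLabel_eq_iff hi hj]

theorem cutIdeal_injective (h : cutIdeal K G S = cutIdeal K G T) : S = T := by
  ext i
  rw [← X_inl_mem_cutIdeal (K := K) (G := G), h, X_inl_mem_cutIdeal]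

theorem cutIdeal_le_labelIdeal {l : V → Option ℕ} (h0 : ∀ i ∈ S, l i = none)
    (h1 : ∀ i j, l i ≠ none → l j ≠ none → Conn G S i j → l i = l j) :
    cutIdeal K G S ≤ labelIdeal K l := by
  refine labelIdeal_le_labelIdeal (fun i hi => h0 i (compLabel_eq_none.1 hi)) (fun i j hij => ?_)
  by_cases hi : l i = none
  · exact Or.inl hi
  by_cases hj : l j = none
  · exact Or.inr (Or.inl hj)
  refine Or.inr (Or.inr (h1 i j hi hj ?_))
  exact (compLabel_eq_iff (fun h => hi (h0 i h)) (fun h => hj (h0 j h))).1 hij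

/-- Any prime determines a labelling: blank where both variables of the column vanish, and elsewhere
by proportionality classes. The auxiliary graph `H` turns these classes into components. -/
theorem exists_labelling_of_isPrime {q : Ideal (MvPolynomial (V ⊕ V) K)} (hq : q.IsPrime) :
    ∃ l : V → Option ℕ, (∀ i, l i = none ↔ X (Sum.inl i) ∈ q ∧ X (Sum.inr i) ∈ q) ∧
      (∀ i j, l i ≠ none → l j ≠ none → (l i = l j ↔ minor K i j ∈ q)) ∧ labelIdeal K l ≤ q := by
  let U : Set V := {i | X (Sum.inl i) ∈ q ∧ X (Sum.inr i) ∈ q}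
  let H : SimpleGraph V :=
    { Adj := fun i j => i ≠ j ∧ minor K i j ∈ q
      symm := ⟨fun i j h => ⟨h.1.symm, minor_symm_mem h.2⟩⟩
      loopless := ⟨fun i h => h.1 rfl⟩ }
  have hself : ∀ i, minor K i i ∈ q := fun i => by simp [minor]
  have hconn : ∀ i j, i ∉ U → j ∉ U → (Conn H U i j ↔ minor K i j ∈ q) := by
    intro i j hi hj
    constructor
    · intro h
      exact h.induct (p := fun w => minor K i w ∈ q) (hself i)
        (fun a b ha _ hab h => minor_trans_mem hq h hab.2 ha.right)
    · intro h
      by_cases hij : i = j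
      · rw [hij]
        exact Conn.refl hj
      · exact Conn.of_adj hi hj ⟨hij, h⟩
  have h0 : ∀ i, compLabel H U i = none ↔ X (Sum.inl i) ∈ q ∧ X (Sum.inr i) ∈ q :=
    fun i => compLabel_eq_none
  have h1 : ∀ i j, compLabel H U i ≠ none → compLabel H U j ≠ none →
      (compLabel H U i = compLabel H U j ↔ minor K i j ∈ q) := by
    intro i j hi hj
    rw [Ne, compLabel_eq_none] at hi hj
    rw [compLabel_eq_iff hi hj, hconn i j hi hj]
  exact ⟨compLabel H U, h0, h1, labelIdeal_le hq (fun i hi => ((h0 i).1 hi).1)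
    (fun i hi => ((h0 i).1 hi).2) (fun i j hij hi => (h1 i j hi (hij ▸ hi)).1 hij)⟩

theorem binomialEdgeIdeal_le_cutIdeal : binomialEdgeIdeal K G ≤ cutIdeal K G S := by
  rw [binomialEdgeIdeal, Ideal.span_le]
  rintro f ⟨i, j, h, rfl⟩
  refine minor_mem_cutIdeal.2 ?_
  by_cases hi : i ∈ S
  · exact Or.inl hi
  by_cases hj : j ∈ S
  · exact Or.inr (Or.inl hj)
  exact Or.inr (Or.inr (Conn.of_adj hi hj h))

/-- Take for $T$ the columns vanishing modulo $q$. Adjacent columns outside $T$ are proportional, so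
the labelling of $q$ is constant on components. -/
theorem exists_cutIdeal_le {q : Ideal (MvPolynomial (V ⊕ V) K)} (hq : q.IsPrime)
    (hG : binomialEdgeIdeal K G ≤ q) : ∃ T : Set V, cutIdeal K G T ≤ q := by
  obtain ⟨l, h0, h1, hl⟩ := exists_labelling_of_isPrime hq
  refine ⟨blank l, (cutIdeal_le_labelIdeal (fun i hi => hi) ?_).trans hl⟩
  intro i j _ _ hc
  refine hc.induct (p := fun w => l i = l w) rfl ?_
  intro a b ha hb hab h
  exact h.trans ((h1 a b ha.right hb).2 (hG (minor_mem_binomialEdgeIdeal hab)))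

/-- A smaller prime would contain the ideal of some $T\subseteq S$. A vertex of $S\setminus T$ then
joins two neighbours that $S$ separates, which puts a minor into the smaller ideal that the larger
one does not contain. -/
theorem cutIdeal_mem_minimalPrimes (hS : IsCutSet G S) :
    cutIdeal K G S ∈ (binomialEdgeIdeal K G).minimalPrimes := by
  refine ⟨⟨inferInstance, binomialEdgeIdeal_le_cutIdeal⟩, ?_⟩
  rintro q ⟨hq, hGq⟩ hqS
  obtain ⟨T, hT⟩ := exists_cutIdeal_le hq hGq
  have hTS : T ⊆ S := fun i hi =>
    X_inl_mem_cutIdeal.1 (hqS (hT ((X_inl_mem_cutIdeal (K := K)).2 hi)))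
  have : T = S := by
    refine hTS.antisymm fun i hi => ?_
    by_contra hiT
    obtain ⟨a, b, ha, hb, hia, hib, hab⟩ := isCutSet_iff.1 hS i hi
    have h1 : Conn G T a b := (Conn.of_adj (fun h => ha (hTS h)) hiT hia.symm).trans
      (Conn.of_adj hiT (fun h => hb (hTS h)) hib)
    have h2 : minor K a b ∈ cutIdeal K G S :=
      hqS (hT (minor_mem_cutIdeal.2 (Or.inr (Or.inr h1))))
    rcases minor_mem_cutIdeal.1 h2 with h | h | h
    exacts [ha h, hb h, hab h]
  exact this ▸ hT

theorem exists_isCutSet_of_mem_minimalPrimes {p : Ideal (MvPolynomial (V ⊕ V) K)}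
    (hp : p ∈ (binomialEdgeIdeal K G).minimalPrimes) : ∃ S, IsCutSet G S ∧ p = cutIdeal K G S := by
  obtain ⟨S, hS⟩ := exists_cutIdeal_le hp.1.1 hp.1.2
  obtain rfl : p = cutIdeal K G S :=
    le_antisymm (hp.2 ⟨inferInstance, binomialEdgeIdeal_le_cutIdeal⟩ hS) hS
  refine ⟨S, isCutSet_iff.2 fun i hi => ?_, rfl⟩
  by_contra hcon
  push Not at hcon
  -- If $i$ separates nothing, dropping it from $S$ gives a strictly smaller prime over $J_G$,
  -- against minimality.
  have hle : cutIdeal K G (S \ {i}) ≤ cutIdeal K G S := by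
    refine cutIdeal_le_labelIdeal (fun j hj => compLabel_eq_none.2 hj.1) ?_
    intro x y hx hy hxy
    rw [Ne, compLabel_eq_none] at hx hy
    exact (compLabel_eq_iff hx hy).2 (hxy.of_diff_singleton hx hy hi hcon)
  have := hp.2 ⟨inferInstance, binomialEdgeIdeal_le_cutIdeal⟩ hle
  exact (X_inl_mem_cutIdeal.1 (this (X_inl_mem_cutIdeal.2 hi))).2 rfl

theorem cutIdeal_height {h : ℕ} (hh : h + compCount G S = S.ncard + Nat.card V) :
    (cutIdeal K G S).height = h :=
  labelIdeal_height _ (by rw [ncard_labels_compLabel, blank_compLabel, hh])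

/-- The combinatorial form of unmixedness for connected graphs. -/
def CutUnmixed (G : SimpleGraph V) : Prop :=
  ∀ S, IsCutSet G S → compCount G S = S.ncard + 1

/-- The height $|S|+|V|-c(S)$ is compared with the height $|V|-1$ belonging to the empty cut set. -/
theorem Unmixed.cutUnmixed (hc : G.Connected) (hu : Unmixed (binomialEdgeIdeal K G)) :
    CutUnmixed G := by
  intro S hS
  have h1 := hu _ (cutIdeal_mem_minimalPrimes hS) _ (cutIdeal_mem_minimalPrimes (isCutSet_empty G))
  have := hc.nonempty
  have hV : 0 < Nat.card V := Nat.card_pos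
  have hle := blank_add_labels_le (compLabel G S)
  rw [blank_compLabel, ncard_labels_compLabel] at hle
  rw [cutIdeal_height (h := S.ncard + Nat.card V - compCount G S) (by omega),
    cutIdeal_height (h := Nat.card V - 1)
      (by rw [compCount_empty hc, Set.ncard_empty]; omega)] at h1
  have h2 : S.ncard + Nat.card V - compCount G S = Nat.card V - 1 := by exact_mod_cast h1
  omega

theorem CutUnmixed.card_pos (hu : CutUnmixed G) : 0 < Nat.card V := by
  have h := hu ∅ (isCutSet_empty G)
  have hle := blank_add_labels_le (compLabel G ∅)
  rw [blank_compLabel, ncard_labels_compLabel, h] at hle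
  omega

theorem CutUnmixed.cutIdeal_height (hu : CutUnmixed G) (hS : IsCutSet G S) :
    (cutIdeal K G S).height = (Nat.card V - 1 : ℕ) := by
  have := hu.card_pos
  exact BinomialEdge.cutIdeal_height (by rw [hu S hS]; omega)

theorem CutUnmixed.height (hu : CutUnmixed G) :
    (binomialEdgeIdeal K G).height = (Nat.card V - 1 : ℕ) := by
  refine le_antisymm ?_ ?_
  · rw [← hu.cutIdeal_height (K := K) (isCutSet_empty G)]
    exact Ideal.height_mono binomialEdgeIdeal_le_cutIdeal
  · rw [Ideal.height_eq_inf_minimalPrimes]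
    refine le_iInf₂ fun p hp => ?_
    obtain ⟨S, hS, rfl⟩ := exists_isCutSet_of_mem_minimalPrimes hp
    rw [hu.cutIdeal_height hS]

end MinimalPrimes

/-! ### Adjacency in the dual graph in terms of cut sets -/

section DualGraph

variable {K : Type v} [Field K] {V : Type u} [Finite V] {G : SimpleGraph V} {S T : Set V}

/-- Where `l` is defined it is coarser than `m`, so it uses at most as many labels; with equal
numbers the two partitions agree there. -/
theorem ncard_labels_le {l m : V → Option ℕ} (h0 : ∀ x, l x ≠ none → m x ≠ none)
    (h1 : ∀ x y, l x ≠ none → l y ≠ none → m x = m y → l x = l y) :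
    (labels l).ncard ≤ (labels m).ncard ∧ ((labels m).ncard ≤ (labels l).ncard →
      ∀ x y, l x ≠ none → l x = l y → m x = m y) := by
  obtain ⟨r, hr, hr'⟩ := exists_transversal l
  let D : Set V := {i | l i ≠ none ∧ r i = i}
  have hsome : ∀ i, l i ≠ none → m i = some ((m i).getD 0) := by
    intro i hi
    obtain ⟨c, hc⟩ := Option.ne_none_iff_exists'.1 (h0 i hi)
    simp [hc]
  have hmaps : ∀ i ∈ D, (m i).getD 0 ∈ labels m := fun i hi => ⟨i, hsome i hi.1⟩
  have hinj : Set.InjOn (fun i => (m i).getD 0) D := by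
    intro i hi j hj hij
    have : m i = m j := by rw [hsome i hi.1, hsome j hj.1]; simpa using hij
    rw [← hi.2, ← hj.2]
    exact hr' i j (h1 i j hi.1 hj.1 this)
  rw [← ncard_transversal hr hr']
  refine ⟨Set.ncard_le_ncard_of_injOn _ hmaps hinj (labels_finite m), fun hle => ?_⟩
  have himg : (fun i => (m i).getD 0) '' D = labels m :=
    Set.eq_of_subset_of_ncard_le (Set.image_subset_iff.2 hmaps)
      (by rwa [hinj.ncard_image]) (labels_finite m)
  have key : ∀ x, l x ≠ none → m x = m (r x) := by
    intro x hx
    have : (m x).getD 0 ∈ labels m := ⟨x, hsome x hx⟩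
    rw [← himg] at this
    obtain ⟨i, hi, hix⟩ := this
    have hmi : m i = m x := by rw [hsome i hi.1, hsome x hx]; simpa using hix
    have hli := h1 i x hi.1 hx hmi
    rw [← hmi, ← hr' i x hli, hi.2]
  intro x y hx hxy
  rw [key x hx, key y (hxy ▸ hx), hr' x y hxy]

/-- Two cut sets either differ by one element, or are obtained from each other by exchanging one
element without changing the connectivity outside of their union. -/
def CutAdj (G : SimpleGraph V) (S T : Set V) : Prop :=
  (∃ t, t ∉ S ∧ T = insert t S) ∨ (∃ s, s ∉ T ∧ S = insert s T) ∨
  (∃ s t, s ∈ S ∧ s ∉ T ∧ t ∈ T ∧ t ∉ S ∧ S ⊆ insert s T ∧ T ⊆ insert t S ∧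
    ∀ x y, x ∉ S ∪ T → y ∉ S ∪ T → (Conn G S x y ↔ Conn G T x y))

/-- The labelling that is blank on $S\cup T$ and otherwise follows the components of $G\setminus S$
gives a prime over the sum. `hadj` keeps every component of $G\setminus S$ represented, so there are
$|S|+1$ blanks and $|S|+1$ labels, hence height $|V|$. -/
theorem sup_cutIdeal_height_le (hS : compCount G S = S.ncard + 1)
    (hU : (S ∪ T).ncard = S.ncard + 1)
    (hadj : ∀ x ∈ T, x ∉ S → ∃ y, y ∉ S ∪ T ∧ G.Adj x y)
    (hconn : ∀ x y, x ∉ S ∪ T → y ∉ S ∪ T → Conn G T x y → Conn G S x y) :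
    (cutIdeal K G S ⊔ cutIdeal K G T).height ≤ Nat.card V := by
  classical
  let l : V → Option ℕ := fun x => if x ∈ S ∪ T then none else compLabel G S x
  have hl : ∀ x, x ∉ S ∪ T → l x = compLabel G S x := fun x hx => by simp only [l, hx, if_false]
  have hnone : ∀ x, l x = none ↔ x ∈ S ∪ T := by
    intro x
    by_cases hx : x ∈ S ∪ T
    · simp only [l, hx, if_true]
    · rw [hl x hx, compLabel_eq_none]
      exact ⟨fun h => Or.inl h, fun h => (hx h).elim⟩
  have hblank : blank l = S ∪ T := Set.ext hnone
  have hlabels : labels l = labels (compLabel G S) := by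
    ext c
    constructor
    · rintro ⟨x, hx⟩
      have hxU : x ∉ S ∪ T := fun h => by rw [(hnone x).2 h] at hx; cases hx
      exact ⟨x, by rw [← hl x hxU, hx]⟩
    · rintro ⟨x, hx⟩
      have hxS : x ∉ S := fun h => by rw [compLabel_eq_none.2 h] at hx; cases hx
      by_cases hxT : x ∈ T
      · obtain ⟨y, hy, hxy⟩ := hadj x hxT hxS
        have hyS : y ∉ S := fun h => hy (Or.inl h)
        exact ⟨y, by rw [hl y hy, ← hx, compLabel_eq_iff hyS hxS]; exact .of_adj hyS hxS hxy.symm⟩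
      · exact ⟨x, by rw [hl x (fun h => h.elim hxS hxT), hx]⟩
  have hh : (labelIdeal K l).height = Nat.card V := labelIdeal_height l (by
    rw [hlabels, ncard_labels_compLabel, hblank, hS, hU]; omega)
  rw [← hh]
  refine Ideal.height_mono (sup_le ?_ ?_)
  · refine cutIdeal_le_labelIdeal (fun i hi => (hnone i).2 (Or.inl hi)) (fun i j hi hj hij => ?_)
    rw [Ne, hnone] at hi hj
    rw [hl i hi, hl j hj, compLabel_eq_iff hij.left hij.right]
    exact hij
  · refine cutIdeal_le_labelIdeal (fun i hi => (hnone i).2 (Or.inr hi)) (fun i j hi hj hij => ?_)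
    rw [Ne, hnone] at hi hj
    rw [hl i hi, hl j hj, compLabel_eq_iff (fun h => hi (Or.inl h)) (fun h => hj (Or.inl h))]
    exact hconn i j hi hj hij

theorem CutAdj.sup_height_le (hu : CutUnmixed G) (hS : IsCutSet G S) (hT : IsCutSet G T)
    (h : CutAdj G S T) : (cutIdeal K G S ⊔ cutIdeal K G T).height ≤ Nat.card V := by
  have nested : ∀ (A B : Set V), IsCutSet G A → IsCutSet G B → (∃ t, t ∉ A ∧ B = insert t A) →
      (cutIdeal K G A ⊔ cutIdeal K G B).height ≤ Nat.card V := by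
    rintro A B hA hB ⟨t, ht, rfl⟩
    have hAB : A ∪ insert t A = insert t A :=
      Set.union_eq_self_of_subset_left (Set.subset_insert _ _)
    refine sup_cutIdeal_height_le (hu A hA) ?_ ?_ ?_
    · rw [hAB, Set.ncard_insert_of_notMem ht]
    · intro x hx _
      obtain ⟨a, b, ha, -, hxa, -⟩ := isCutSet_iff.1 hB x hx
      exact ⟨a, by rwa [hAB], hxa⟩
    · intro x y _ _ hxy
      exact hxy.mono (Set.subset_insert _ _)
  rcases h with h | h | ⟨s, t, hsS, hsT, htT, htS, hST, hTS, hconn⟩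
  · exact nested S T hS hT h
  · rw [sup_comm]
    exact nested T S hT hS h
  · have hU : S ∪ T = insert t S := by
      refine (Set.union_subset (Set.subset_insert _ _) hTS).antisymm ?_
      rintro x (rfl | hx)
      exacts [Or.inr htT, Or.inl hx]
    refine sup_cutIdeal_height_le (hu S hS) ?_ ?_ (fun x y hx hy h => (hconn x y hx hy).2 h)
    · rw [hU, Set.ncard_insert_of_notMem htS]
    · intro x hx hxS
      obtain ⟨a, b, ha, hb, hxa, hxb, hab⟩ := isCutSet_iff.1 hT x hx
      by_cases has : a = s
      · refine ⟨b, ?_, hxb⟩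
        rintro (hbS | hbT)
        · rcases hST hbS with hbs | hbT
          · exact hab (by rw [has, ← hbs]; exact Conn.refl hb)
          · exact hb hbT
        · exact hb hbT
      · refine ⟨a, ?_, hxa⟩
        rintro (haS | haT)
        · rcases hST haS with rfl | haT
          · exact has rfl
          · exact ha haT
        · exact ha haT

/-- A prime of height $|V|$ over the sum has a labelling with at least as many labels as blanks, and
at most $|S|+1$ and $|T|+1$ labels. Its blank set contains $S\cup T$, so $S$ and $T$ each miss at
most one blank. If $|S|=|T|$, all these bounds are equalities, and the labels are at once the
components for $S$ and for $T$ outside $S\cup T$. -/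
theorem cutAdj_of_sup_height (hu : CutUnmixed G) (hS : IsCutSet G S) (hT : IsCutSet G T)
    (hne : S ≠ T) (h : (cutIdeal K G S ⊔ cutIdeal K G T).height = Nat.card V) :
    CutAdj G S T := by
  obtain ⟨q, hq, hle, hqh⟩ := Ideal.exists_isPrime_height_eq h
  obtain ⟨l, h0, h1, hl⟩ := exists_labelling_of_isPrime hq
  have hSq : cutIdeal K G S ≤ q := le_sup_left.trans hle
  have hTq : cutIdeal K G T ≤ q := le_sup_right.trans hle
  have hblank : ∀ A : Set V, cutIdeal K G A ≤ q → A ⊆ blank l := fun A hA i hi =>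
    (h0 i).2 ⟨hA (X_inl_mem_cutIdeal.2 hi), hA (X_inr_mem_cutIdeal.2 hi)⟩
  have hconn : ∀ A : Set V, cutIdeal K G A ≤ q → ∀ x y, l x ≠ none → l y ≠ none →
      Conn G A x y → l x = l y := fun A hA x y hx hy hxy =>
    (h1 x y hx hy).2 (hA (minor_mem_cutIdeal.2 (Or.inr (Or.inr hxy))))
  have hcomp : ∀ A : Set V, IsCutSet G A → cutIdeal K G A ≤ q →
      (labels l).ncard ≤ A.ncard + 1 ∧ (A.ncard + 1 ≤ (labels l).ncard →
        ∀ x y, l x ≠ none → l x = l y → Conn G A x y) := by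
    intro A hA hAq
    have hxA : ∀ x, l x ≠ none → x ∉ A := fun x hx h => hx (hblank A hAq h)
    have := ncard_labels_le (l := l) (m := compLabel G A)
      (fun x hx => by rw [Ne, compLabel_eq_none]; exact hxA x hx)
      (fun x y hx hy hxy => hconn A hAq x y hx hy ((compLabel_eq_iff (hxA x hx) (hxA y hy)).1 hxy))
    rw [ncard_labels_compLabel, hu A hA] at this
    exact ⟨this.1, fun h x y hx hxy =>
      (compLabel_eq_iff (hxA x hx) (hxA y (hxy ▸ hx))).1 (this.2 h x y hx hxy)⟩
  have hbl : (blank l).ncard ≤ (labels l).ncard := by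
    have hb := blank_add_labels_le l
    have hk := labelIdeal_height (K := K) l
      (h := (blank l).ncard + Nat.card V - (labels l).ncard) (by omega)
    have := Ideal.height_mono hl
    rw [hk, hqh] at this
    have : (blank l).ncard + Nat.card V - (labels l).ncard ≤ Nat.card V := by exact_mod_cast this
    omega
  obtain ⟨hS1, hS2⟩ := hcomp S hS hSq
  obtain ⟨hT1, hT2⟩ := hcomp T hT hTq
  have hSb := hblank S hSq
  have hTb := hblank T hTq
  have hSn := Set.ncard_le_ncard hSb
  have hTn := Set.ncard_le_ncard hTb
  have nested : ∀ A B : Set V, A.ncard < B.ncard → (blank l).ncard ≤ A.ncard + 1 →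
      A ⊆ blank l → B ⊆ blank l → ∃ t, t ∉ A ∧ B = insert t A := by
    intro A B hAB hA hAb hBb
    have hB : B = blank l := Set.eq_of_subset_of_ncard_le hBb (by omega)
    have hsub : A ⊆ B := hB ▸ hAb
    have hc := Set.ncard_sdiff_add_ncard_of_subset hsub
    have : (B \ A).ncard = 1 := by
      have := Set.ncard_le_ncard hBb
      omega
    obtain ⟨t, ht⟩ := Set.ncard_eq_one.1 this
    have htB : t ∈ B \ A := ht ▸ rfl
    refine ⟨t, htB.2, ?_⟩
    rw [← Set.union_sdiff_cancel hsub, ht, Set.union_singleton]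
  rcases lt_trichotomy S.ncard T.ncard with hlt | heq | hlt
  · exact Or.inl (nested S T hlt (hbl.trans hS1) hSb hTb)
  · have hU : S ∪ T ⊆ blank l := Set.union_subset hSb hTb
    have hUn := Set.ncard_le_ncard hU
    have e1 : (S \ T).ncard + T.ncard = (S ∪ T).ncard := by
      rw [← Set.ncard_union_eq (Set.disjoint_sdiff_left), Set.sdiff_union_self]
    have e2 : (T \ S).ncard + S.ncard = (S ∪ T).ncard := by
      rw [← Set.ncard_union_eq (Set.disjoint_sdiff_left), Set.sdiff_union_self, Set.union_comm]
    have hne1 : (T \ S).ncard ≠ 0 := by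
      intro h0
      have hTS : T ⊆ S := by rwa [Set.ncard_eq_zero, Set.sdiff_eq_empty] at h0
      exact hne (Set.eq_of_subset_of_ncard_le hTS heq.le).symm
    obtain ⟨s, hs⟩ := Set.ncard_eq_one.1 (show (S \ T).ncard = 1 by omega)
    obtain ⟨t, ht⟩ := Set.ncard_eq_one.1 (show (T \ S).ncard = 1 by omega)
    have hs' : s ∈ S \ T := hs ▸ rfl
    have ht' : t ∈ T \ S := ht ▸ rfl
    have hUb : S ∪ T = blank l := Set.eq_of_subset_of_ncard_le hU (by omega)
    have hx : ∀ x, x ∉ S ∪ T → l x ≠ none := fun x hx => by rw [hUb] at hx; exact hx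
    refine Or.inr (Or.inr ⟨s, t, hs'.1, hs'.2, ht'.1, ht'.2, ?_, ?_, fun x y hxU hyU => ⟨?_, ?_⟩⟩)
    · intro x hxS
      by_cases hxT : x ∈ T
      · exact Or.inr hxT
      · exact Or.inl (hs ▸ (⟨hxS, hxT⟩ : x ∈ S \ T) : x ∈ ({s} : Set V))
    · intro x hxT
      by_cases hxS : x ∈ S
      · exact Or.inr hxS
      · exact Or.inl (ht ▸ (⟨hxT, hxS⟩ : x ∈ T \ S) : x ∈ ({t} : Set V))
    · intro hc
      exact hT2 (by omega) x y (hx x hxU) (hconn S hSq x y (hx x hxU) (hx y hyU) hc)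
    · intro hc
      exact hS2 (by omega) x y (hx x hxU) (hconn T hTq x y (hx x hxU) (hx y hyU) hc)
  · exact Or.inr (Or.inl (nested T S hlt (hbl.trans hT1) hTb hSb))

theorem dualGraph_adj_iff (hu : CutUnmixed G) (hS : IsCutSet G S) (hT : IsCutSet G T) :
    (dualGraph (binomialEdgeIdeal K G)).Adj ⟨cutIdeal K G S, cutIdeal_mem_minimalPrimes hS⟩
      ⟨cutIdeal K G T, cutIdeal_mem_minimalPrimes hT⟩ ↔ S ≠ T ∧ CutAdj G S T := by
  have hpos := hu.card_pos
  have hn : ((Nat.card V - 1 : ℕ) : ℕ∞) + 1 = Nat.card V := by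
    exact_mod_cast Nat.sub_add_cancel hpos
  simp only [dualGraph, Ne, Subtype.mk.injEq, hu.cutIdeal_height hS, hu.cutIdeal_height hT,
    hu.height, and_true, hn]
  constructor
  · rintro ⟨hne, hh⟩
    have hne' : S ≠ T := fun h => hne (h ▸ rfl)
    exact ⟨hne', cutAdj_of_sup_height hu hS hT hne' hh⟩
  · rintro ⟨hne, hadj⟩
    refine ⟨fun h => hne (cutIdeal_injective h), le_antisymm (hadj.sup_height_le hu hS hT) ?_⟩
    rw [← hn, ← hu.cutIdeal_height (K := K) hS]
    have hlt : cutIdeal K G S < cutIdeal K G S ⊔ cutIdeal K G T := by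
      refine lt_of_le_of_ne le_sup_left fun h => hne ?_
      have hTS : cutIdeal K G T ≤ cutIdeal K G S := h ▸ le_sup_right
      exact cutIdeal_injective (le_antisymm ((cutIdeal_mem_minimalPrimes hS).2
        ⟨inferInstance, binomialEdgeIdeal_le_cutIdeal⟩ hTS) hTS)
    exact Order.add_one_le_of_lt (Ideal.height_strict_mono_of_isPrime hlt)

end DualGraph

/-! ### The two sides of a cut vertex -/

section Split

variable {V : Type u} {G : SimpleGraph V} {v : V} {A B S : Set V}

/-- The complement of `v` consists of two connected components `A` and `B`, both of which contain
neighbours of `v`. -/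
structure Split (G : SimpleGraph V) (v : V) (A B : Set V) : Prop where
  cover : ∀ x, x = v ∨ x ∈ A ∨ x ∈ B
  notMem_left : v ∉ A
  notMem_right : v ∉ B
  disjoint : ∀ x ∈ A, x ∉ B
  not_adj : ∀ a ∈ A, ∀ b ∈ B, ¬ G.Adj a b
  conn_left : ∀ x ∈ A, ∀ y ∈ A, Conn G {v} x y
  conn_right : ∀ x ∈ B, ∀ y ∈ B, Conn G {v} x y
  adj_left : ∃ a ∈ A, G.Adj v a
  adj_right : ∃ b ∈ B, G.Adj v b

theorem Split.symm (h : Split G v A B) : Split G v B A where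
  cover x := (h.cover x).imp_right Or.symm
  notMem_left := h.notMem_right
  notMem_right := h.notMem_left
  disjoint x hx hx' := h.disjoint x hx' hx
  not_adj a ha b hb hab := h.not_adj b hb a ha hab.symm
  conn_left := h.conn_right
  conn_right := h.conn_left
  adj_left := h.adj_right
  adj_right := h.adj_left

theorem Split.mem_left_of_adj (h : Split G v A B) {a b : V} (ha : a ∈ A) (hab : G.Adj a b)
    (hb : b ≠ v) : b ∈ A :=
  ((h.cover b).resolve_left hb).resolve_right fun hbB => h.not_adj a ha b hbB hab

theorem conn_of_compCount_le_two [Finite V] (h : compCount G S ≤ 2) {x y z : V} (hx : x ∉ S)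
    (hy : y ∉ S) (hz : z ∉ S) (hxy : ¬ Conn G S x y) (hxz : ¬ Conn G S x z) : Conn G S y z := by
  by_contra hyz
  rw [← part_eq_part hx] at hxy hxz
  rw [← part_eq_part hy] at hyz
  have : 2 < (part G S '' Sᶜ).ncard := (Set.two_lt_ncard (Set.toFinite _)).2
    ⟨_, ⟨x, hx, rfl⟩, _, ⟨y, hy, rfl⟩, _, ⟨z, hz, rfl⟩, hxy, hxz, hyz⟩
  rw [compCount_eq_ncard] at h
  omega

theorem not_conn_of_not_adj (hdisj : ∀ x ∈ A, x ∉ B)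
    (hcover : ∀ x, x = v ∨ x ∈ A ∨ x ∈ B) (hnadj : ∀ a ∈ A, ∀ b ∈ B, ¬ G.Adj a b) {a b : V}
    (ha : a ∈ A) (hb : b ∈ B) : ¬ Conn G {v} a b := by
  intro h
  refine hdisj b (h.mem_of_closed ha ?_) hb
  intro x y hx _ hy hxy
  exact ((hcover y).resolve_left hy).resolve_right fun hyB => hnadj x hx y hyB hxy

/-- Since $\{v\}$ is a cut set, $c(\{v\})=2$; so both sides are automatically connected. -/
theorem CutUnmixed.split [Finite V] (hu : CutUnmixed G) (hA : v ∉ A) (hB : v ∉ B)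
    (hdisj : ∀ x ∈ A, x ∉ B) (hcover : ∀ x, x = v ∨ x ∈ A ∨ x ∈ B)
    (hnadj : ∀ a ∈ A, ∀ b ∈ B, ¬ G.Adj a b) (hva : ∃ a ∈ A, G.Adj v a)
    (hvb : ∃ b ∈ B, G.Adj v b) : Split G v A B := by
  have hA' : ∀ a ∈ A, a ∉ ({v} : Set V) := by
    rintro a ha rfl
    exact hA ha
  have hB' : ∀ a ∈ B, a ∉ ({v} : Set V) := by
    rintro a ha rfl
    exact hB ha
  have hn := fun a ha b hb =>
    not_conn_of_not_adj hdisj hcover hnadj (a := a) (b := b) ha hb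
  obtain ⟨a, ha, hva'⟩ := hva
  obtain ⟨b, hb, hvb'⟩ := hvb
  have hcut : IsCutSet G {v} := by
    rw [isCutSet_iff]
    rintro i rfl
    exact ⟨a, b, hA' a ha, hB' b hb, hva', hvb', hn a ha b hb⟩
  have htwo : compCount G {v} ≤ 2 := by rw [hu _ hcut, Set.ncard_singleton]
  exact ⟨hcover, hA, hB, hdisj, hnadj,
    fun x hx y hy => conn_of_compCount_le_two htwo (hB' b hb) (hA' x hx) (hA' y hy)
      (fun h => hn x hx b hb h.symm) (fun h => hn y hy b hb h.symm),
    fun x hx y hy => conn_of_compCount_le_two htwo (hA' a ha) (hB' x hx) (hB' y hy)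
      (fun h => hn a ha x hx h) (fun h => hn a ha y hy h), ⟨a, ha, hva'⟩, ⟨b, hb, hvb'⟩⟩

theorem CutUnmixed.exists_split [Finite V] (hu : CutUnmixed G) (hv : IsCutVertex G v) :
    ∃ A B, Split G v A B := by
  obtain ⟨a, b, ha, hb, hva, hvb, hab⟩ := isCutSet_iff.1 hv v rfl
  refine ⟨part G {v} a, {x | x ≠ v ∧ x ∉ part G {v} a}, hu.split (fun h => h.right rfl)
    (fun h => h.1 rfl) (fun x hx hx' => hx'.2 hx) (fun x => ?_) (fun x hx y hy hxy => ?_)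
    ⟨a, Conn.refl ha, hva⟩ ⟨b, ⟨hb, hab⟩, hvb⟩⟩
  · by_cases h1 : x = v
    · exact Or.inl h1
    · by_cases h2 : x ∈ part G {v} a
      · exact Or.inr (Or.inl h2)
      · exact Or.inr (Or.inr ⟨h1, h2⟩)
  · exact hy.2 (Conn.trans hx (Conn.of_adj (Conn.right hx) hy.1 hxy))

/-- The components meeting $X$ are the same for $S$ and $T$, and the component of $w$ for $T$ is not
among them. -/
theorem ncard_image_part_lt [Finite V] {T X : Set V}
    (hX : ∀ x ∈ X, x ∉ T ∧ part G S x = part G T x) {w : V} (hw : w ∉ T)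
    (hwX : ∀ x ∈ X, ¬ Conn G T x w) : (part G S '' X).ncard < compCount G T := by
  rw [compCount_eq_ncard]
  refine Set.ncard_lt_ncard ⟨?_, fun h => ?_⟩ (Set.toFinite _)
  · rintro _ ⟨x, hx, rfl⟩
    exact ⟨x, (hX x hx).1, (hX x hx).2.symm⟩
  · obtain ⟨x, hx, hxw⟩ := h ⟨w, hw, rfl⟩
    rw [(hX x hx).2, part_eq_part (hX x hx).1] at hxw
    exact hwX x hx hxw

/-- Suppose all neighbours of $v$ in $A$ lie in $S$. Then $S\cap A$ and $S\setminus A$ are again cut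
sets. The components of $G\setminus S$ inside $A$ are components for $S\cap A$ other than that of
$v$, and those inside $B$ are components for $S\setminus A$ other than those in $A$. So there are at
most $|S\cap A|+|S\setminus A|=|S|$ of them, against $c(S)=|S|+1$. -/
theorem Split.exists_adj_left [Finite V] (hs : Split G v A B) (hu : CutUnmixed G)
    (hS : IsCutSet G S) (hv : v ∈ S) : ∃ a ∈ A, a ∉ S ∧ G.Adj v a := by
  by_contra hcon
  push Not at hcon
  have hsB := hs.symm
  have hcl : ∀ x y, x ∈ A → x ∉ S ∩ A → G.Adj x y → y ∈ A := by
    intro x y hx hxS hxy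
    refine hs.mem_left_of_adj hx hxy ?_
    rintro rfl
    exact hcon x hx (fun h => hxS ⟨h, hx⟩) hxy.symm
  have hclB : ∀ x y, x ∈ B → y ∉ S \ A → G.Adj x y → y ∈ B := by
    intro x y hx hy hxy
    refine hsB.mem_left_of_adj hx hxy ?_
    rintro rfl
    exact hy ⟨hv, hs.notMem_left⟩
  have hconnA : ∀ x ∈ A, ∀ y, Conn G (S ∩ A) x y → Conn G S x y := by
    intro x hx y h
    exact h.of_subset hx (fun a b ha ha' _ hab => hcl a b ha ha' hab)
      (fun a ha ha' h => ha' ⟨h, ha⟩)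
  have hconnB : ∀ x ∈ B, ∀ y, Conn G (S \ A) x y → Conn G S x y := by
    intro x hx y h
    exact h.of_subset hx (fun a b ha _ hb hab => hclB a b ha hb hab)
      (fun a ha ha' h => ha' ⟨h, hsB.disjoint a ha⟩)
  have hcutA : IsCutSet G (S ∩ A) := by
    rw [isCutSet_iff]
    rintro i ⟨hiS, hiA⟩
    obtain ⟨a, b, ha, hb, hia, hib, hab⟩ := isCutSet_iff.1 hS i hiS
    have haA : a ∈ A := hs.mem_left_of_adj hiA hia (by rintro rfl; exact ha hv)
    exact ⟨a, b, fun h => ha h.1, fun h => hb h.1, hia, hib, fun h => hab (hconnA a haA b h)⟩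
  have hcutB : IsCutSet G (S \ A) := by
    rw [isCutSet_iff]
    rintro i ⟨hiS, hiA⟩
    obtain ⟨a, b, ha, hb, hia, hib, hab⟩ := isCutSet_iff.1 hS i hiS
    have haB : a ∈ B := by
      rcases hs.cover i with rfl | hi | hi
      · rcases hs.cover a with rfl | haA | haB
        · exact (ha hv).elim
        · exact (hcon a haA ha hia).elim
        · exact haB
      · exact (hiA hi).elim
      · exact hsB.mem_left_of_adj hi hia (by rintro rfl; exact ha hv)
    exact ⟨a, b, fun h => ha h.1, fun h => hb h.1, hia, hib, fun h => hab (hconnB a haB b h)⟩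
  have hvS : v ∉ S ∩ A := fun h => hs.notMem_left h.2
  have h1 : (part G S '' (A \ S)).ncard < compCount G (S ∩ A) := by
    refine ncard_image_part_lt (w := v) (fun x hx => ⟨fun h => hx.2 h.1, ?_⟩) hvS fun x hx h => ?_
    · ext y
      exact ⟨fun h => Conn.mono h Set.inter_subset_left, hconnA x hx.1 y⟩
    · exact (hconnA x hx.1 v h).right hv
  obtain ⟨a, ha, -⟩ := hs.adj_left
  have h2 : (part G S '' (B \ S)).ncard < compCount G (S \ A) := by
    refine ncard_image_part_lt (w := a) (fun x hx => ⟨fun h => hx.2 h.1, ?_⟩) (fun h => h.2 ha)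
      fun x hx h => ?_
    · ext y
      exact ⟨fun h => Conn.mono h Set.sdiff_subset, hconnB x hx.1 y⟩
    · exact hs.disjoint a ha (h.mem_of_closed hx.1 fun x y hx _ hy hxy => hclB x y hx hy hxy)
  have h3 : compCount G S ≤ (part G S '' (A \ S)).ncard + (part G S '' (B \ S)).ncard := by
    rw [compCount_eq_ncard]
    refine (Set.ncard_le_ncard ?_ (Set.toFinite _)).trans (Set.ncard_union_le _ _)
    rintro _ ⟨x, hx, rfl⟩
    rcases hs.cover x with rfl | hxA | hxB
    · exact (hx hv).elim
    · exact Or.inl ⟨x, ⟨hxA, hx⟩, rfl⟩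
    · exact Or.inr ⟨x, ⟨hxB, hx⟩, rfl⟩
  have h4 := Set.ncard_inter_add_ncard_sdiff_eq_ncard S A (Set.toFinite _)
  rw [hu S hS] at h3
  rw [hu _ hcutA] at h1
  rw [hu _ hcutB] at h2
  omega

end Split

/-! ### Restricting cut sets to a subgraph whose leaf replaces one side of a cut vertex -/

section LeafEmbedding

variable {V : Type u} {V₁ : Type w}

/-- An embedding of a graph with a leaf `f` attached to `v` onto an induced subgraph such that
only `f` and `v` have neighbours beyond the image of the remaining graph. -/
structure LeafEmbedding (G₁ : SimpleGraph V₁) (G : SimpleGraph V) where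
  toEmb : G₁ ↪g G
  f : V₁
  v : V₁
  adj : G₁.Adj f v
  eq_of_adj : ∀ x, G₁.Adj f x → x = v
  closed : ∀ x y, x ≠ f → x ≠ v → G.Adj (toEmb x) y → ∃ z, z ≠ f ∧ toEmb z = y

namespace LeafEmbedding

variable {G₁ : SimpleGraph V₁} {G : SimpleGraph V} (e : LeafEmbedding G₁ G)

open Classical in
/-- The retraction that sends everything beyond the image to the leaf. -/
noncomputable def retr (y : V) : V₁ := if h : ∃ x, x ≠ e.f ∧ e.toEmb x = y then h.choose else e.f

theorem toEmb_retr {y : V} (h : e.retr y ≠ e.f) : e.toEmb (e.retr y) = y := by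
  by_cases hy : ∃ x, x ≠ e.f ∧ e.toEmb x = y
  · simp only [retr, hy, dite_true]
    exact hy.choose_spec.2
  · simp [retr, hy] at h

theorem retr_toEmb (x : V₁) : e.retr (e.toEmb x) = x := by
  by_cases hx : x = e.f
  · by_contra h
    have h1 : e.retr (e.toEmb x) ≠ e.f := fun h' => h (h'.trans hx.symm)
    exact h (e.toEmb.injective (e.toEmb_retr h1))
  · have hy : ∃ z, z ≠ e.f ∧ e.toEmb z = e.toEmb x := ⟨x, hx, rfl⟩
    simp only [retr, hy, dite_true]
    exact e.toEmb.injective hy.choose_spec.2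

theorem retr_eq_v {y : V} : e.retr y = e.v ↔ y = e.toEmb e.v := by
  constructor
  · intro h
    rw [← h, e.toEmb_retr]
    rw [h]
    exact (G₁.ne_of_adj e.adj).symm
  · rintro rfl
    exact e.retr_toEmb _

theorem retr_adj {a b : V} (hab : G.Adj a b) :
    e.retr a = e.retr b ∨ G₁.Adj (e.retr a) (e.retr b) := by
  have aux : ∀ a b, G.Adj a b → e.retr a ≠ e.f → e.retr b = e.f → G₁.Adj (e.retr a) (e.retr b) := by
    intro a b hab ha hb
    by_cases hav : e.retr a = e.v
    · rw [hav, hb]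
      exact e.adj.symm
    · rw [← e.toEmb_retr ha] at hab
      obtain ⟨z, hz, rfl⟩ := e.closed _ _ ha hav hab
      rw [e.retr_toEmb] at hb
      exact (hz hb).elim
  by_cases ha : e.retr a = e.f <;> by_cases hb : e.retr b = e.f
  · exact Or.inl (ha.trans hb.symm)
  · exact Or.inr (aux b a hab.symm hb ha).symm
  · exact Or.inr (aux a b hab ha hb)
  · rw [← e.toEmb_retr ha, ← e.toEmb_retr hb, e.toEmb.map_adj_iff] at hab
    exact Or.inr hab

/-- The trace of a set of vertices on the embedded graph without its leaf. -/
def proj (S : Set V) : Set V₁ := {x | x ≠ e.f ∧ e.toEmb x ∈ S}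

variable {e} {S T : Set V}

theorem f_notMem_proj : e.f ∉ e.proj S := fun h => h.1 rfl

theorem retr_notMem_proj {a : V} (ha : a ∉ S) : e.retr a ∉ e.proj S := fun h =>
  ha (e.toEmb_retr h.1 ▸ h.2)

theorem conn_retr {a b : V} (h : Conn G S a b) : Conn G₁ (e.proj S) (e.retr a) (e.retr b) :=
  h.map (fun _ ha => retr_notMem_proj ha) fun _ _ ha hb hab => (e.retr_adj hab).imp_right
    (Conn.of_adj (retr_notMem_proj ha) (retr_notMem_proj hb))

theorem conn_of_conn_toEmb {x y : V₁} (h : Conn G S (e.toEmb x) (e.toEmb y)) :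
    Conn G₁ (e.proj S) x y := by
  simpa only [e.retr_toEmb] using e.conn_retr h

/-- The image of $f$ may lie in $S$, but a walk that visits $f$ comes from $v$ and returns to $v$,
so the visit can be cut out. -/
theorem conn_toEmb {x y : V₁} (h : Conn G₁ (e.proj S) x y) (hx : x ≠ e.f) (hy : y ≠ e.f) :
    Conn G S (e.toEmb x) (e.toEmb y) := by
  have hn : ∀ w, w ≠ e.f → w ∉ e.proj S → e.toEmb w ∉ S := fun w hw hw' h => hw' ⟨hw, h⟩
  refine (h.induct (p := fun w => (w ≠ e.f → Conn G S (e.toEmb x) (e.toEmb w)) ∧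
    (w = e.f → Conn G S (e.toEmb x) (e.toEmb e.v)))
    ⟨fun _ => Conn.refl (hn x hx h.left), fun h => (hx h).elim⟩ ?_).1 hy
  intro a b ha hb hab ⟨h1, h2⟩
  constructor
  · intro hbf
    by_cases haf : a = e.f
    · rw [e.eq_of_adj b (haf ▸ hab)]
      exact h2 haf
    · exact (h1 haf).trans (Conn.of_adj (hn a haf ha.right) (hn b hbf hb)
        (e.toEmb.map_adj_iff.2 hab))
  · rintro rfl
    have hav := e.eq_of_adj a hab.symm
    rw [← hav]
    exact h1 (G₁.ne_of_adj hab)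

theorem f_notMem_of_isCutSet [Finite V₁] {R : Set V₁} (hR : IsCutSet G₁ R) : e.f ∉ R := by
  intro hf
  obtain ⟨a, b, ha, hb, hfa, hfb, hab⟩ := isCutSet_iff.1 hR e.f hf
  rw [e.eq_of_adj a hfa] at ha hab
  rw [e.eq_of_adj b hfb] at hab
  exact hab (Conn.refl ha)

theorem proj_image {R : Set V₁} (hR : e.f ∉ R) : e.proj (e.toEmb '' R) = R := by
  ext x
  constructor
  · rintro ⟨-, y, hy, hyx⟩
    exact e.toEmb.injective hyx ▸ hy
  · intro hx
    exact ⟨fun h => hR (h ▸ hx), x, hx, rfl⟩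

theorem isCutSet_image [Finite V] [Finite V₁] {R : Set V₁} (hR : IsCutSet G₁ R) :
    IsCutSet G (e.toEmb '' R) := by
  rw [isCutSet_iff]
  rintro _ ⟨i, hi, rfl⟩
  obtain ⟨a, b, ha, hb, hia, hib, hab⟩ := isCutSet_iff.1 hR i hi
  refine ⟨e.toEmb a, e.toEmb b, ?_, ?_, e.toEmb.map_adj_iff.2 hia, e.toEmb.map_adj_iff.2 hib,
    fun h => hab ?_⟩
  · rintro ⟨x, hx, hxa⟩
    exact ha (e.toEmb.injective hxa ▸ hx)
  · rintro ⟨x, hx, hxa⟩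
    exact hb (e.toEmb.injective hxa ▸ hx)
  · simpa only [proj_image (f_notMem_of_isCutSet hR)] using conn_of_conn_toEmb h

/-- The sides of $v$ in $G$ are $G_1\setminus\{f,v\}$ and the fibre of `retr` over $f$. The former
is nonempty by `hA`, and connectedness of $G$ gives $v$ a neighbour in it. -/
theorem split [Finite V] (e : LeafEmbedding G₁ G) (hc : G.Connected) (hu : CutUnmixed G)
    (hA : ∃ a, a ≠ e.f ∧ a ≠ e.v) :
    Split G (e.toEmb e.v) {y | e.retr y ≠ e.f ∧ e.retr y ≠ e.v} {y | e.retr y = e.f} := by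
  have hvf : e.v ≠ e.f := (G₁.ne_of_adj e.adj).symm
  refine hu.split (fun h => h.2 (e.retr_toEmb _)) (fun h => hvf ((e.retr_toEmb _).symm.trans h))
    (fun x hx => hx.1) (fun x => ?_) (fun a ha b hb hab => ?_) ?_
    ⟨e.toEmb e.f, e.retr_toEmb _, e.toEmb.map_adj_iff.2 e.adj.symm⟩
  · by_cases h1 : e.retr x = e.v
    · exact Or.inl (e.retr_eq_v.1 h1)
    · by_cases h2 : e.retr x = e.f
      · exact Or.inr (Or.inr h2)
      · exact Or.inr (Or.inl ⟨h2, h1⟩)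
  · rcases e.retr_adj hab with h | h
    · exact ha.1 (h.trans hb)
    · rw [show e.retr b = e.f from hb] at h
      exact ha.2 (e.eq_of_adj _ h.symm)
  · by_contra hcon
    push Not at hcon
    obtain ⟨a, haf, hav⟩ := hA
    have h : Conn G ∅ (e.toEmb a) (e.toEmb e.f) := conn_empty_iff.2 (hc.preconnected _ _)
    have := h.mem_of_closed (X := {y | e.retr y ≠ e.f ∧ e.retr y ≠ e.v})
      (by simpa only [Set.mem_ofPred_eq, e.retr_toEmb] using ⟨haf, hav⟩) ?_
    · exact this.1 (e.retr_toEmb _)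
    · intro x y hx _ _ hxy
      have hyv : e.retr y ≠ e.v := by
        intro h
        rw [e.retr_eq_v.1 h] at hxy
        exact hcon x hx hxy.symm
      refine ⟨fun h => ?_, hyv⟩
      rcases e.retr_adj hxy with h' | h'
      · exact hx.1 (h'.trans h)
      · rw [h] at h'
        exact hx.2 (e.eq_of_adj _ h'.symm)

theorem isCutSet_proj [Finite V] [Finite V₁] (hc : G.Connected) (hu : CutUnmixed G)
    (hA : ∃ a, a ≠ e.f ∧ a ≠ e.v) (hS : IsCutSet G S) : IsCutSet G₁ (e.proj S) := by
  have hs := e.split hc hu hA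
  rw [isCutSet_iff]
  rintro i ⟨hif, hiS⟩
  by_cases hiv : i = e.v
  · subst hiv
    -- For $v\in S$ the separated neighbours are $f$, isolated once $v$ is removed, and a surviving
    -- neighbour of $v$ inside $G_1$.
    obtain ⟨a, ha, haS, hva⟩ := hs.exists_adj_left hu hS hiS
    refine ⟨e.f, e.retr a, f_notMem_proj, retr_notMem_proj haS, e.adj.symm, ?_, fun h => ?_⟩
    · rw [← e.toEmb_retr ha.1] at hva
      exact e.toEmb.map_adj_iff.1 hva
    · refine ha.1 (h.mem_of_closed (X := {e.f}) rfl ?_)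
      rintro x y rfl _ hy hxy
      exact (hy (e.eq_of_adj y hxy ▸ ⟨hif, hiS⟩)).elim
  · obtain ⟨a, b, ha, hb, hia, hib, hab⟩ := isCutSet_iff.1 hS _ hiS
    obtain ⟨a, haf, rfl⟩ := e.closed _ _ hif hiv hia
    obtain ⟨b, hbf, rfl⟩ := e.closed _ _ hif hiv hib
    exact ⟨a, b, fun h => ha h.2, fun h => hb h.2, e.toEmb.map_adj_iff.1 hia,
      e.toEmb.map_adj_iff.1 hib, fun h => hab (conn_toEmb h haf hbf)⟩

/-- A cut set $R$ of $G_1$ avoids $f$, and $G_1\setminus R$ and $G\setminus R$ have equally many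
components because the far side of $v$ is connected and contracts to $f$. -/
theorem cutUnmixed [Finite V] [Finite V₁] (e : LeafEmbedding G₁ G) (hc : G.Connected)
    (hu : CutUnmixed G) (hA : ∃ a, a ≠ e.f ∧ a ≠ e.v) : CutUnmixed G₁ := by
  intro R hR
  have hs := e.split hc hu hA
  have hf : e.f ∉ R := f_notMem_of_isCutSet hR
  have hp := proj_image (e := e) hf
  have hnot : ∀ x, x ∉ R → e.toEmb x ∉ e.toEmb '' R := by
    rintro x hx ⟨y, hy, hyx⟩
    exact hx (e.toEmb.injective hyx ▸ hy)
  have hcard : (e.toEmb '' R).ncard = R.ncard := Set.ncard_image_of_injective _ e.toEmb.injective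
  rw [← hcard, ← hu _ (isCutSet_image hR)]
  refine le_antisymm (compCount_le e.toEmb hnot fun x y _ _ h => ?_)
    (compCount_le e.retr (fun x hx => ?_) fun x y hx hy h => ?_)
  · rw [← hp]
    exact conn_of_conn_toEmb h
  · rw [← hp]
    exact retr_notMem_proj hx
  · have hret : ∀ x, x ∉ e.toEmb '' R → Conn G (e.toEmb '' R) x (e.toEmb (e.retr x)) := by
      intro x hx
      by_cases hxf : e.retr x = e.f
      · rw [hxf]
        refine (hs.conn_right x hxf _ (e.retr_toEmb e.f)).of_subset
          (X := {y | e.retr y = e.f}) hxf ?_ ?_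
        · intro a b ha _ hb hab
          exact hs.symm.mem_left_of_adj ha hab hb
        · rintro _ ha _ ⟨y, hy, rfl⟩
          rw [Set.mem_ofPred_eq, e.retr_toEmb] at ha
          exact hf (ha ▸ hy)
      · rw [e.toEmb_retr hxf]
        exact Conn.refl hx
    refine (hret x hx).trans (Conn.trans ?_ (hret y hy).symm)
    exact h.map hnot fun a b ha hb hab =>
      Or.inr (Conn.of_adj (hnot a ha) (hnot b hb) (e.toEmb.map_adj_iff.2 hab))

/-- Only connections with $f$ need care, since the image of $f$ may belong to $S\cup T$. They pass
through $v$, so $v\notin T$. If $v\in S$, a neighbour $z$ of $v$ on the far side and outside $S$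
replaces $f$; it is outside $T$ too, as the only possible new element $t$ is not on the far side. -/
theorem conn_proj_of_exchange [Finite V] [Finite V₁] (hc : G.Connected) (hu : CutUnmixed G)
    (hA : ∃ a, a ≠ e.f ∧ a ≠ e.v) (hS : IsCutSet G S) {t : V} (ht : e.retr t ≠ e.f)
    (hTS : T ⊆ insert t S)
    (hconn : ∀ x y, x ∉ S ∪ T → y ∉ S ∪ T → Conn G T x y → Conn G S x y) {x y : V₁}
    (hx : x ∉ e.proj S ∪ e.proj T) (hy : y ∉ e.proj S ∪ e.proj T)
    (h : Conn G₁ (e.proj T) x y) : Conn G₁ (e.proj S) x y := by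
  have hs := e.split hc hu hA
  have hout : ∀ w, w ≠ e.f → w ∉ e.proj S ∪ e.proj T → e.toEmb w ∉ S ∪ T := by
    rintro w hw hw' (h | h)
    exacts [hw' (Or.inl ⟨hw, h⟩), hw' (Or.inr ⟨hw, h⟩)]
  have hfS : e.f ∉ e.proj S := f_notMem_proj
  have key : ∀ y, y ≠ e.f → y ∉ e.proj S ∪ e.proj T → Conn G₁ (e.proj T) e.f y →
      Conn G₁ (e.proj S) e.f y := by
    intro y hyf hy h
    have hvy : Conn G₁ (e.proj T) e.v y := by
      refine (h.induct (p := fun w => w = e.f ∨ Conn G₁ (e.proj T) e.v w)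
        (Or.inl rfl) ?_).resolve_left hyf
      rintro a b ha hb hab (rfl | hva)
      · right
        rw [e.eq_of_adj b hab] at hb ⊢
        exact Conn.refl hb
      · exact Or.inr (hva.trans (Conn.of_adj hva.right hb hab))
    have hvf : e.v ≠ e.f := (G₁.ne_of_adj e.adj).symm
    have hGvy := conn_toEmb hvy hvf hyf
    by_cases hvS : e.toEmb e.v ∈ S
    · obtain ⟨z, hz, hzS, hvz⟩ := hs.symm.exists_adj_left hu hS hvS
      have hzT : z ∉ T := by
        intro hzT
        rcases hTS hzT with rfl | h
        exacts [ht hz, hzS h]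
      have hzy : Conn G T z (e.toEmb y) := (Conn.of_adj hzT hGvy.left hvz.symm).trans hGvy
      have := e.conn_retr (hconn z _ (fun h => h.elim hzS hzT) (hout y hyf hy) hzy)
      rwa [e.retr_toEmb, show e.retr z = e.f from hz] at this
    · have hvST : e.toEmb e.v ∉ S ∪ T := fun h => h.elim hvS hGvy.left
      have := conn_of_conn_toEmb (hconn _ _ hvST (hout y hyf hy) hGvy)
      exact (Conn.of_adj hfS this.left e.adj).trans this
  by_cases hxf : x = e.f <;> by_cases hyf : y = e.f
  · subst hxf hyf
    exact Conn.refl hfS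
  · subst hxf
    exact key y hyf hy h
  · subst hyf
    exact (key x hxf hx h.symm).symm
  · exact conn_of_conn_toEmb (hconn _ _ (hout x hxf hx) (hout y hyf hy) (conn_toEmb h hxf hyf))

theorem proj_insert {t : V} (ht : e.retr t ≠ e.f) :
    e.proj (insert t S) = insert (e.retr t) (e.proj S) := by
  ext x
  constructor
  · rintro ⟨hx, rfl | h⟩
    · exact Or.inl (e.retr_toEmb x).symm
    · exact Or.inr ⟨hx, h⟩
  · rintro (rfl | h)
    · exact ⟨ht, Or.inl (e.toEmb_retr ht)⟩
    · exact ⟨h.1, Or.inr h.2⟩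

theorem proj_insert_of_eq {t : V} (ht : e.retr t = e.f) : e.proj (insert t S) = e.proj S := by
  ext x
  constructor
  · rintro ⟨hx, rfl | h⟩
    · exact (hx ((e.retr_toEmb x).symm.trans ht)).elim
    · exact ⟨hx, h⟩
  · rintro h
    exact ⟨h.1, Or.inr h.2⟩

theorem proj_mono (h : S ⊆ T) : e.proj S ⊆ e.proj T := fun _ hx => ⟨hx.1, h hx.2⟩

theorem retr_mem_proj {t : V} (ht : e.retr t ≠ e.f) : e.retr t ∈ e.proj S ↔ t ∈ S := by
  constructor
  · intro h
    have := h.2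
    rwa [e.toEmb_retr ht] at this
  · intro h
    exact ⟨ht, by rwa [e.toEmb_retr ht]⟩

/-- An exchanged element on the far side of $v$ disappears under `proj`, so an exchange can become
an equality, an insertion or an exchange. -/
theorem cutAdj_proj [Finite V] [Finite V₁] (hc : G.Connected) (hu : CutUnmixed G)
    (hA : ∃ a, a ≠ e.f ∧ a ≠ e.v) (hS : IsCutSet G S) (hT : IsCutSet G T) (h : CutAdj G S T) :
    e.proj S = e.proj T ∨ CutAdj G₁ (e.proj S) (e.proj T) := by
  have nested : ∀ (A B : Set V), (∃ t, t ∉ A ∧ B = insert t A) →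
      e.proj A = e.proj B ∨ ∃ t, t ∉ e.proj A ∧ e.proj B = insert t (e.proj A) := by
    rintro A B ⟨t, ht, rfl⟩
    by_cases htf : e.retr t = e.f
    · exact Or.inl (proj_insert_of_eq htf).symm
    · exact Or.inr ⟨e.retr t, fun h => ht ((retr_mem_proj htf).1 h), proj_insert htf⟩
  rcases h with h | h | ⟨s, t, hsS, hsT, htT, htS, hST, hTS, hconn⟩
  · exact (nested S T h).imp_right Or.inl
  · exact (nested T S h).imp Eq.symm fun h => Or.inr (Or.inl h)
  · have h1 := proj_mono (e := e) hST
    have h2 := proj_mono (e := e) hTS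
    by_cases hsf : e.retr s = e.f <;> by_cases htf : e.retr t = e.f
    · rw [proj_insert_of_eq hsf] at h1
      rw [proj_insert_of_eq htf] at h2
      exact Or.inl (h1.antisymm h2)
    · rw [proj_insert_of_eq hsf] at h1
      rw [proj_insert htf] at h2
      refine Or.inr (Or.inl ⟨e.retr t, fun h => htS ((retr_mem_proj htf).1 h), ?_⟩)
      exact h2.antisymm (Set.insert_subset ((retr_mem_proj htf).2 htT) h1)
    · rw [proj_insert hsf] at h1
      rw [proj_insert_of_eq htf] at h2
      refine Or.inr (Or.inr (Or.inl ⟨e.retr s, fun h => hsT ((retr_mem_proj hsf).1 h), ?_⟩))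
      exact h1.antisymm (Set.insert_subset ((retr_mem_proj hsf).2 hsS) h2)
    · rw [proj_insert hsf] at h1
      rw [proj_insert htf] at h2
      refine Or.inr (Or.inr (Or.inr ⟨e.retr s, e.retr t, (retr_mem_proj hsf).2 hsS,
        fun h => hsT ((retr_mem_proj hsf).1 h), (retr_mem_proj htf).2 htT,
        fun h => htS ((retr_mem_proj htf).1 h), h1, h2, fun x y hx hy => ⟨?_, ?_⟩⟩))
      · refine conn_proj_of_exchange hc hu hA hT hsf hST (fun x y hx hy => ?_)
          (Set.union_comm _ _ ▸ hx) (Set.union_comm _ _ ▸ hy)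
        exact (hconn x y (Set.union_comm _ _ ▸ hx) (Set.union_comm _ _ ▸ hy)).1
      · exact conn_proj_of_exchange hc hu hA hS htf hTS (fun x y hx hy => (hconn x y hx hy).2) hx hy

theorem dualGraph_connected [Finite V] [Finite V₁] (e : LeafEmbedding G₁ G) (K : Type v) [Field K]
    (hc : G.Connected) (hu : CutUnmixed G) (hD : (dualGraph (binomialEdgeIdeal K G)).Connected) :
    (dualGraph (binomialEdgeIdeal K G₁)).Connected := by
  by_cases hA : ∃ a, a ≠ e.f ∧ a ≠ e.v
  · have hu₁ := e.cutUnmixed hc hu hA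
    choose A hA' hpA using fun p : (binomialEdgeIdeal K G).minimalPrimes =>
      exists_isCutSet_of_mem_minimalPrimes p.2
    let F : (binomialEdgeIdeal K G).minimalPrimes → (binomialEdgeIdeal K G₁).minimalPrimes :=
      fun p => ⟨cutIdeal K G₁ (e.proj (A p)),
        cutIdeal_mem_minimalPrimes (isCutSet_proj hc hu hA (hA' p))⟩
    have hp : ∀ p : (binomialEdgeIdeal K G).minimalPrimes,
        p = ⟨cutIdeal K G (A p), cutIdeal_mem_minimalPrimes (hA' p)⟩ :=
      fun p => Subtype.ext (hpA p)
    have hF : ∀ p q, (dualGraph (binomialEdgeIdeal K G)).Adj p q →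
        (dualGraph (binomialEdgeIdeal K G₁)).Reachable (F p) (F q) := by
      intro p q hpq
      rw [hp p, hp q, dualGraph_adj_iff hu (hA' p) (hA' q)] at hpq
      by_cases heq : e.proj (A p) = e.proj (A q)
      · rw [show F p = F q from Subtype.ext (by simp only [F, heq])]
      · have hadj := (cutAdj_proj hc hu hA (hA' p) (hA' q) hpq.2).resolve_left heq
        exact SimpleGraph.Adj.reachable ((dualGraph_adj_iff hu₁ (isCutSet_proj hc hu hA (hA' p))
          (isCutSet_proj hc hu hA (hA' q))).2 ⟨heq, hadj⟩)
    have hF' : ∀ p q, (dualGraph (binomialEdgeIdeal K G₁)).Reachable (F p) (F q) := by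
      intro p q
      have := hD.preconnected p q
      rw [SimpleGraph.reachable_iff_reflTransGen] at this
      induction this with
      | refl => exact SimpleGraph.Reachable.refl _
      | tail _ h ih => exact ih.trans (hF _ _ h)
    have hsurj : Function.Surjective F := by
      rintro ⟨p, hpm⟩
      obtain ⟨R, hR, rfl⟩ := exists_isCutSet_of_mem_minimalPrimes hpm
      let q : (binomialEdgeIdeal K G).minimalPrimes :=
        ⟨cutIdeal K G (e.toEmb '' R), cutIdeal_mem_minimalPrimes (isCutSet_image hR)⟩
      refine ⟨q, Subtype.ext ?_⟩
      have : A q = e.toEmb '' R := (cutIdeal_injective (K := K) (G := G) (hpA q)).symm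
      simp only [F, this, proj_image (f_notMem_of_isCutSet hR)]
    have : Nonempty (binomialEdgeIdeal K G₁).minimalPrimes := hD.nonempty.map F
    refine ⟨fun p q => ?_⟩
    obtain ⟨p, rfl⟩ := hsurj p
    obtain ⟨q, rfl⟩ := hsurj q
    exact hF' p q
  -- Here $G_1$ is a single edge, whose only cut set is empty, and its dual graph is a point.
  · push Not at hA
    have hempty : ∀ R, IsCutSet G₁ R → R = ∅ := by
      intro R hR
      rw [Set.eq_empty_iff_forall_notMem]
      intro i hi
      have hf : e.f ∉ R := f_notMem_of_isCutSet hR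
      have hi' : i = e.v := hA i (by rintro rfl; exact hf hi)
      subst hi'
      obtain ⟨a, b, ha, hb, hia, hib, hab⟩ := isCutSet_iff.1 hR _ hi
      have h1 : ∀ c, c ∉ R → c = e.f := by
        intro c hc
        by_contra hcf
        exact hc (hA c hcf ▸ hi)
      rw [h1 a ha, h1 b hb] at hab
      exact hab (Conn.refl hf)
    have : Nonempty (binomialEdgeIdeal K G₁).minimalPrimes :=
      ⟨⟨_, cutIdeal_mem_minimalPrimes (isCutSet_empty G₁)⟩⟩
    have : Subsingleton (binomialEdgeIdeal K G₁).minimalPrimes := by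
      refine ⟨?_⟩
      rintro ⟨p, hp⟩ ⟨q, hq⟩
      obtain ⟨S, hS, rfl⟩ := exists_isCutSet_of_mem_minimalPrimes hp
      obtain ⟨T, hT, rfl⟩ := exists_isCutSet_of_mem_minimalPrimes hq
      rw [Subtype.mk.injEq, hempty S hS, hempty T hT]
    exact ⟨fun p q => Subsingleton.elim p q ▸ SimpleGraph.Reachable.refl _⟩

end LeafEmbedding

end LeafEmbedding

/-! ### Both gluing operations are symmetric and provide leaf embeddings -/

section Gluing

variable {V : Type u} {V₁ : Type v} {V₂ : Type w} {G : SimpleGraph V} {G₁ : SimpleGraph V₁}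
  {G₂ : SimpleGraph V₂}

theorem IsLeaf.exists_adj {f : V} (h : IsLeaf G f) :
    ∃ v, G.Adj f v ∧ ∀ x, G.Adj f x → x = v := by
  obtain ⟨v, hv⟩ := Set.ncard_eq_one.1 h
  have hmem : ∀ x, G.Adj f x ↔ x = v := fun x => Set.ext_iff.1 hv x
  exact ⟨v, (hmem v).2 rfl, fun x hx => (hmem x).1 hx⟩

theorem isLeaf_of_adj {f v : V} (h : G.Adj f v) (h' : ∀ x, G.Adj f x → x = v) : IsLeaf G f :=
  Set.ncard_eq_one.2 ⟨v, Set.ext fun x => ⟨h' x, fun hx => by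
    rw [Set.mem_singleton_iff] at hx
    rw [hx]
    exact h⟩⟩

/-- The first graph as an induced subgraph of a glued graph. -/
def glueInl (G₁ : SimpleGraph V₁) (a : V₁) (G₂ : SimpleGraph V₂) (b : V₂) :
    G₁ ↪g glue G₁ a G₂ b where
  toFun := Sum.inl
  inj' := Sum.inl_injective
  map_rel_iff' := Iff.rfl

open Classical in
/-- The second graph as an induced subgraph of a glued graph. -/
noncomputable def glueInr (G₁ : SimpleGraph V₁) (a : V₁) (G₂ : SimpleGraph V₂) (b : V₂) :
    G₂ ↪g glue G₁ a G₂ b where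
  toFun y := if h : y = b then Sum.inl a else Sum.inr ⟨y, h⟩
  inj' x y h := by
    by_cases hx : x = b <;> by_cases hy : y = b <;> simp_all
  map_rel_iff' := by
    intro x y
    by_cases hx : x = b <;> by_cases hy : y = b
    · simp [hx, hy]
    · simp [hx, hy, glue]
    · simp [hx, hy, glue, G₂.adj_comm]
    · simp [hx, hy, glue]

theorem glueInr_self (a : V₁) (b : V₂) : glueInr G₁ a G₂ b b = Sum.inl a :=
  dif_pos rfl

theorem glueInr_of_ne (a : V₁) {b y : V₂} (h : y ≠ b) :
    glueInr G₁ a G₂ b y = Sum.inr ⟨y, h⟩ :=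
  dif_neg h

/-- Recognition criterion: two induced subgraphs covering $G$, meeting in one vertex, with no edge
between the remainders. -/
theorem nonempty_iso_glue {a : V₁} {b : V₂} (e₁ : G₁ ↪g G) (e₂ : G₂ ↪g G) (hab : e₁ a = e₂ b)
    (hcover : ∀ y, (∃ x, e₁ x = y) ∨ ∃ x, e₂ x = y) (hinter : ∀ x y, e₁ x = e₂ y → y = b)
    (hadj : ∀ x y, G.Adj (e₁ x) (e₂ y) → x = a ∨ y = b) : Nonempty (G ≃g glue G₁ a G₂ b) := by
  let f : V₁ ⊕ {y : V₂ // y ≠ b} → V := Sum.elim e₁ (fun y => e₂ y.1)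
  have hinj : Function.Injective f := by
    rintro (x | y) (x' | y') h
    · exact congrArg Sum.inl (e₁.injective h)
    · exact (y'.2 (hinter _ _ h)).elim
    · exact (y.2 (hinter _ _ (Eq.symm h))).elim
    · exact congrArg Sum.inr (Subtype.ext (e₂.injective h))
  have hsurj : Function.Surjective f := by
    intro z
    rcases hcover z with ⟨x, rfl⟩ | ⟨y, rfl⟩
    · exact ⟨Sum.inl x, rfl⟩
    · by_cases hy : y = b
      · exact ⟨Sum.inl a, by rw [hy, ← hab]; rfl⟩
      · exact ⟨Sum.inr ⟨y, hy⟩, rfl⟩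
  have hmixed : ∀ (x : V₁) (y : {y : V₂ // y ≠ b}),
      G.Adj (e₁ x) (e₂ y.1) ↔ x = a ∧ G₂.Adj b y.1 := by
    intro x y
    constructor
    · intro h
      obtain rfl := (hadj _ _ h).resolve_right y.2
      rw [hab, e₂.map_adj_iff] at h
      exact ⟨rfl, h⟩
    · rintro ⟨rfl, h⟩
      rw [hab, e₂.map_adj_iff]
      exact h
  refine ⟨(RelIso.symm ⟨Equiv.ofBijective f ⟨hinj, hsurj⟩, ?_⟩ : G ≃g glue G₁ a G₂ b)⟩
  rintro (x | y) (x' | y')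
  · exact e₁.map_adj_iff
  · exact hmixed x y'
  · exact (G.adj_comm _ _).trans (hmixed x' y)
  · exact e₂.map_adj_iff

theorem nonempty_glue_comm (a : V₁) (b : V₂) :
    Nonempty (glue G₁ a G₂ b ≃g glue G₂ b G₁ a) := by
  refine nonempty_iso_glue (glueInr G₁ a G₂ b) (glueInl G₁ a G₂ b) (glueInr_self a b) ?_ ?_ ?_
  · rintro (x | y)
    · exact Or.inr ⟨x, rfl⟩
    · exact Or.inl ⟨y.1, glueInr_of_ne a y.2⟩
  · intro y x h
    by_cases hy : y = b
    · rw [hy, glueInr_self] at h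
      exact (Sum.inl_injective h).symm
    · rw [glueInr_of_ne a hy] at h
      cases h
  · intro y x h
    by_cases hy : y = b
    · exact Or.inl hy
    · rw [glueInr_of_ne a hy] at h
      exact Or.inr h.1

theorem IsStar.symm (h : IsStar G G₁ G₂) : IsStar G G₂ G₁ := by
  obtain ⟨f₁, f₂, h₁, h₂, ⟨i⟩⟩ := h
  obtain ⟨j⟩ := nonempty_glue_comm (G₁ := G₁) (G₂ := G₂) f₁ f₂
  exact ⟨f₂, f₁, h₂, h₁, ⟨i.trans j⟩⟩

theorem IsCirc.symm (h : IsCirc G G₁ G₂) : IsCirc G G₂ G₁ := by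
  obtain ⟨f₁, v₁, h₁, f₂, v₂, h₂, l₁, l₂, d₁, d₂, ⟨i⟩⟩ := h
  exact ⟨f₂, v₂, h₂, f₁, v₁, h₁, l₂, l₁, d₂, d₁, (nonempty_glue_comm _ _).map i.trans⟩

theorem IsStar.nonempty_leafEmbedding (h : IsStar G G₁ G₂) : Nonempty (LeafEmbedding G₁ G) := by
  obtain ⟨f₁, f₂, h₁, h₂, ⟨i⟩⟩ := h
  obtain ⟨v₁, hv, hv'⟩ := h₁.exists_adj
  refine ⟨⟨(glueInl G₁ f₁ G₂ f₂).trans i.symm.toEmbedding, f₁, v₁, hv, hv', ?_⟩⟩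
  intro x y hx hxv hxy
  obtain ⟨z, rfl⟩ := i.symm.surjective y
  replace hxy : (glue G₁ f₁ G₂ f₂).Adj (Sum.inl x) z := i.symm.map_adj_iff.1 hxy
  rcases z with z | z
  · refine ⟨z, ?_, rfl⟩
    rintro rfl
    exact hxv (hv' x (SimpleGraph.Adj.symm hxy))
  · exact (hx hxy.1).elim

theorem exists_ne_adj_of_three_le_deg [Finite V] {v f : V} (h : 3 ≤ deg G v) :
    ∃ z, z ≠ f ∧ G.Adj v z := by
  obtain ⟨a, ha, b, hb, hab⟩ := (Set.one_lt_ncard (Set.toFinite _)).1 (show 1 < deg G v by omega)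
  by_cases haf : a = f
  · exact ⟨b, fun hbf => hab (haf.trans hbf.symm), hb⟩
  · exact ⟨a, haf, ha⟩

open Classical in
theorem IsCirc.nonempty_leafEmbedding [Finite V₂] (h : IsCirc G G₁ G₂) :
    Nonempty (LeafEmbedding G₁ G) := by
  obtain ⟨f₁, v₁, h₁, f₂, v₂, h₂, l₁, l₂, d₁, d₂, ⟨i⟩⟩ := h
  obtain ⟨v', hv', hv⟩ := l₁.exists_adj
  obtain rfl := hv v₁ h₁
  obtain ⟨z, hzf, hz⟩ := exists_ne_adj_of_three_le_deg (f := f₂) d₂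
  -- The leaf $f_1$ was removed from $G$; a neighbour of $v_2$ other than $f_2$ takes its place, and
  -- the degree condition provides one.
  let z' : {y : {y : V₂ // y ≠ f₂} // y ≠ ⟨v₂, h₂.ne'⟩} :=
    ⟨⟨z, hzf⟩, fun h => hz.ne' (congrArg Subtype.val h)⟩
  let e : G₁ ↪g circ G₁ h₁ G₂ h₂ :=
    { toFun := fun x => if h : x = f₁ then Sum.inr z' else Sum.inl ⟨x, h⟩
      inj' := by
        intro x y h
        by_cases hx : x = f₁ <;> by_cases hy : y = f₁ <;> simp_all
      map_rel_iff' := by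
        have hadj : ∀ y, G₁.Adj f₁ y ↔ y = v₁ := fun y => ⟨hv y, fun h => h ▸ h₁⟩
        intro x y
        by_cases hx : x = f₁ <;> by_cases hy : y = f₁
        · simp [hx, hy]
        · simp [hx, hy, circ, glue, hadj, z', hz]
        · simp [hx, hy, circ, glue, G₁.adj_comm x, hadj, z', hz]
        · simp [hx, hy, circ, glue] }
  have he : ∀ x (h : x ≠ f₁), e x = Sum.inl ⟨x, h⟩ := fun x h => dif_neg h
  refine ⟨⟨e.trans i.symm.toEmbedding, f₁, v₁, h₁, hv, ?_⟩⟩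
  intro x y hx hxv hxy
  obtain ⟨w, rfl⟩ := i.symm.surjective y
  replace hxy : (circ G₁ h₁ G₂ h₂).Adj (e x) w := i.symm.map_adj_iff.1 hxy
  rw [he x hx] at hxy
  rcases w with w | w
  · exact ⟨w.1, w.2, congrArg i.symm (he w.1 w.2)⟩
  · exact (hxv (congrArg Subtype.val hxy.1)).elim

end Gluing

/-! ### Decomposing a graph at a cut vertex -/

section Decomposition

variable {V : Type u} {G : SimpleGraph V} {v : V} {A B : Set V}

theorem Split.isStar (hs : Split G v A B) (hA : ∃ a ∈ A, G.Adj v a ∧ ∀ x ∈ A, G.Adj v x → x = a)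
    (hB : ∃ b ∈ B, G.Adj v b ∧ ∀ x ∈ B, G.Adj v x → x = b) :
    IsStar G (G.induce {x | x = v ∨ x ∈ A}) (G.induce {x | x = v ∨ x ∈ B}) := by
  obtain ⟨a, ha, hva, ha'⟩ := hA
  obtain ⟨b, hb, hvb, hb'⟩ := hB
  refine ⟨⟨v, Or.inl rfl⟩, ⟨v, Or.inl rfl⟩,
    isLeaf_of_adj (v := ⟨a, Or.inr ha⟩) (by simpa using hva) ?_,
    isLeaf_of_adj (v := ⟨b, Or.inr hb⟩) (by simpa using hvb) ?_,
    nonempty_iso_glue (SimpleGraph.Embedding.induce _) (SimpleGraph.Embedding.induce _) rfl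
      ?_ ?_ ?_⟩
  · rintro ⟨x, rfl | hx⟩ hvx
    · exact (SimpleGraph.irrefl _ hvx).elim
    · exact Subtype.ext (ha' x hx (by simpa using hvx))
  · rintro ⟨x, rfl | hx⟩ hvx
    · exact (SimpleGraph.irrefl _ hvx).elim
    · exact Subtype.ext (hb' x hx (by simpa using hvx))
  · intro y
    rcases hs.cover y with h | h | h
    · exact Or.inl ⟨⟨y, Or.inl h⟩, rfl⟩
    · exact Or.inl ⟨⟨y, Or.inr h⟩, rfl⟩
    · exact Or.inr ⟨⟨y, Or.inr h⟩, rfl⟩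
  · rintro ⟨x, hx⟩ ⟨y, hy⟩ (rfl : x = y)
    refine Subtype.ext (hx.elim id fun hxA => ?_)
    exact hy.resolve_right (hs.disjoint x hxA)
  · rintro ⟨x, hx⟩ ⟨y, hy⟩ (hxy : G.Adj x y)
    rcases hx with hx | hx
    · exact Or.inl (Subtype.ext hx)
    · rcases hy with hy | hy
      · exact Or.inr (Subtype.ext hy)
      · exact (hs.not_adj x hx y hy hxy).elim

theorem Split.three_le_deg [Finite V] {c : V} (hs : Split G v A B) (hc : c ∈ B) (hvc : G.Adj v c)
    (hA : ∃ a ∈ A, ∃ b ∈ A, a ≠ b ∧ G.Adj v a ∧ G.Adj v b) :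
    3 ≤ deg (G.induce {x | x = c ∨ x = v ∨ x ∈ A}) ⟨v, Or.inr (Or.inl rfl)⟩ := by
  obtain ⟨a, ha, b, hb, hab, hva, hvb⟩ := hA
  refine (Set.two_lt_ncard (Set.toFinite _)).2 ⟨⟨a, Or.inr (Or.inr ha)⟩, by simpa using hva,
    ⟨b, Or.inr (Or.inr hb)⟩, by simpa using hvb, ⟨c, Or.inl rfl⟩, by simpa using hvc, ?_, ?_, ?_⟩
  · simpa using hab
  · rw [Ne, Subtype.mk.injEq]
    rintro rfl
    exact hs.disjoint a ha hc
  · rw [Ne, Subtype.mk.injEq]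
    rintro rfl
    exact hs.disjoint b hb hc

theorem Split.isLeaf_induce {c : V} (hs : Split G v A B) (hc : c ∈ B) (hvc : G.Adj v c) :
    IsLeaf (G.induce {x | x = c ∨ x = v ∨ x ∈ A}) ⟨c, Or.inl rfl⟩ := by
  refine isLeaf_of_adj (v := ⟨v, Or.inr (Or.inl rfl)⟩) (by simpa using hvc.symm) ?_
  rintro ⟨x, rfl | rfl | hx⟩ hcx
  · exact (SimpleGraph.irrefl _ hcx).elim
  · rfl
  · exact (hs.not_adj x hx c hc (by simpa using hcx.symm)).elim

/-- The removed leaf of each factor is modelled by a neighbour of $v$ on the opposite side: $c\in B$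
for the factor on $A$, and $d\in A$ for the factor on $B$. -/
theorem Split.isCirc [Finite V] (hs : Split G v A B)
    (hA : ∃ a ∈ A, ∃ b ∈ A, a ≠ b ∧ G.Adj v a ∧ G.Adj v b)
    (hB : ∃ a ∈ B, ∃ b ∈ B, a ≠ b ∧ G.Adj v a ∧ G.Adj v b) :
    ∃ c d, IsCirc G (G.induce {x | x = c ∨ x = v ∨ x ∈ A})
      (G.induce {x | x = d ∨ x = v ∨ x ∈ B}) := by
  obtain ⟨c, hc, hvc⟩ := hs.adj_right
  obtain ⟨d, hd, hvd⟩ := hs.adj_left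
  refine ⟨c, d, ⟨c, Or.inl rfl⟩, ⟨v, Or.inr (Or.inl rfl)⟩, by simpa using hvc.symm,
    ⟨d, Or.inl rfl⟩, ⟨v, Or.inr (Or.inl rfl)⟩, by simpa using hvd.symm,
    hs.isLeaf_induce hc hvc, hs.symm.isLeaf_induce hd hvd, hs.three_le_deg hc hvc hA,
    hs.symm.three_le_deg hd hvd hB,
    nonempty_iso_glue ((SimpleGraph.Embedding.comap ⟨_, Subtype.val_injective⟩ _).trans
      (SimpleGraph.Embedding.induce _)) ((SimpleGraph.Embedding.comap
      ⟨_, Subtype.val_injective⟩ _).trans (SimpleGraph.Embedding.induce _)) rfl ?_ ?_ ?_⟩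
  · intro y
    rcases hs.cover y with h | h | h
    · exact Or.inl ⟨⟨⟨y, Or.inr (Or.inl h)⟩, fun h' => hvc.ne (h ▸ congrArg Subtype.val h')⟩, rfl⟩
    · exact Or.inl ⟨⟨⟨y, Or.inr (Or.inr h)⟩,
        fun h' => hs.disjoint y h (by rwa [show y = c from congrArg Subtype.val h'])⟩, rfl⟩
    · exact Or.inr ⟨⟨⟨y, Or.inr (Or.inr h)⟩,
        fun h' => hs.symm.disjoint y h (by rwa [show y = d from congrArg Subtype.val h'])⟩, rfl⟩
  · rintro ⟨⟨x, hx⟩, hxc⟩ ⟨⟨y, hy⟩, hyd⟩ (rfl : x = y)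
    have hx' := hx.resolve_left fun h => hxc (Subtype.ext h)
    have hy' := hy.resolve_left fun h => hyd (Subtype.ext h)
    refine Subtype.ext (Subtype.ext (hx'.elim id fun hxA => ?_))
    exact hy'.resolve_right (hs.disjoint x hxA)
  · rintro ⟨⟨x, hx⟩, hxc⟩ ⟨⟨y, hy⟩, hyd⟩ (hxy : G.Adj x y)
    rcases hx.resolve_left fun h => hxc (Subtype.ext h) with hx | hx
    · exact Or.inl (Subtype.ext (Subtype.ext hx))
    · rcases hy.resolve_left fun h => hyd (Subtype.ext h) with hy | hy
      · exact Or.inr (Subtype.ext (Subtype.ext hy))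
      · exact (hs.not_adj x hx y hy hxy).elim

end Decomposition

/-! ### Counting leaves, and the existence of a decomposition -/

section Leaves

variable {V : Type u} {G : SimpleGraph V}

theorem Conn.eq_of_isolated {S : Set V} {a b : V} (h : Conn G S a b)
    (ha : ∀ c, c ∉ S → ¬ G.Adj a c) : a = b := by
  refine h.mem_of_closed (X := {w | a = w}) rfl ?_
  rintro x y (rfl : a = x) _ hy hxy
  exact (ha y hy hxy).elim

theorem exists_two_adj [Finite V] {x : V} (hx : ¬ IsLeaf G x) (h : ∃ y, G.Adj x y) :
    ∃ a b, a ≠ b ∧ G.Adj x a ∧ G.Adj x b := by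
  obtain ⟨y, hy⟩ := h
  have hpos : 0 < (G.neighborSet x).ncard := (Set.ncard_pos (Set.toFinite _)).2 ⟨y, hy⟩
  have hne : (G.neighborSet x).ncard ≠ 1 := hx
  obtain ⟨a, ha, b, hb, hab⟩ := (Set.one_lt_ncard (Set.toFinite _)).1
    (show 1 < (G.neighborSet x).ncard by omega)
  exact ⟨a, b, hab, ha, hb⟩

-- Let $S$ be $D$ without its leaves. Restoring a leaf of $D$ attaches it to a vertex outside $D$
-- and creates no component, so $c(S)=c(D)$; and $S$ is a cut set. The formula is $c(S)=|S|+1$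
-- rewritten for $D$.
open Classical in
theorem CutUnmixed.ncard_add_one_eq [Finite V] (hu : CutUnmixed G) {D : Set V}
    (hleaf : ∀ d ∈ D, IsLeaf G d → ∃ c, c ∉ D ∧ G.Adj d c)
    (hnon : ∀ d ∈ D, ¬ IsLeaf G d →
      ∃ a b, a ∉ D ∧ b ∉ D ∧ G.Adj d a ∧ G.Adj d b ∧ ¬ Conn G D a b) :
    D.ncard + 1 = compCount G D + (D ∩ {x | IsLeaf G x}).ncard := by
  let S : Set V := D \ {x | IsLeaf G x}
  let r : V → V := fun x => if h : x ∈ D ∧ IsLeaf G x then (hleaf x h.1 h.2).choose else x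
  have hrleaf : ∀ x, x ∈ D → IsLeaf G x → r x ∉ D ∧ G.Adj x (r x) := by
    intro x hx hx'
    have h : x ∈ D ∧ IsLeaf G x := ⟨hx, hx'⟩
    simp only [r, h, and_self, dite_true]
    exact (hleaf x hx hx').choose_spec
  have hrid : ∀ x, x ∉ D → r x = x := by
    intro x hx
    simp [r, hx]
  have hcases : ∀ x, x ∉ S → x ∉ D ∨ x ∈ D ∧ IsLeaf G x := by
    intro x hx
    by_cases hxD : x ∈ D
    · exact Or.inr ⟨hxD, not_not.1 fun h => hx ⟨hxD, h⟩⟩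
    · exact Or.inl hxD
  have hSD : S ⊆ D := Set.sdiff_subset
  have hrD : ∀ x, x ∉ S → r x ∉ D := by
    intro x hx
    rcases hcases x hx with h | h
    · rwa [hrid x h]
    · exact (hrleaf x h.1 h.2).1
  have hleafadj : ∀ x y, x ∈ D → IsLeaf G x → G.Adj x y → r x = r y := by
    intro x y hx hx' hxy
    obtain ⟨w, -, hw⟩ := hx'.exists_adj
    have hr := hrleaf x hx hx'
    have : y = r x := (hw y hxy).trans (hw _ hr.2).symm
    rw [this, hrid _ hr.1]
  have hconn : ∀ x y, Conn G S x y → Conn G D (r x) (r y) := by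
    intro x y h
    refine h.map hrD fun a b ha hb hab => ?_
    rcases hcases a ha with h1 | h1
    · rcases hcases b hb with h2 | h2
      · rw [hrid a h1, hrid b h2]
        exact Or.inr (Conn.of_adj h1 h2 hab)
      · exact Or.inl (hleafadj b a h2.1 h2.2 hab.symm).symm
    · exact Or.inl (hleafadj a b h1.1 h1.2 hab)
  have hconn' : ∀ x y, x ∉ D → y ∉ D → Conn G S x y → Conn G D x y := by
    intro x y hx hy h
    have := hconn x y h
    rwa [hrid x hx, hrid y hy] at this
  have hS : IsCutSet G S := by
    rw [isCutSet_iff]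
    rintro i ⟨hiD, hil⟩
    obtain ⟨a, b, ha, hb, hia, hib, hab⟩ := hnon i hiD hil
    exact ⟨a, b, fun h => ha (hSD h), fun h => hb (hSD h), hia, hib,
      fun h => hab (hconn' a b ha hb h)⟩
  have hcount : compCount G S = compCount G D := by
    refine le_antisymm (compCount_le r hrD fun x y hx hy h => ?_)
      (compCount_le id (fun x hx h => hx (hSD h)) hconn')
    have hret : ∀ x, x ∉ S → Conn G S x (r x) := by
      intro x hx
      rcases hcases x hx with h | h
      · rw [hrid x h]
        exact Conn.refl hx
      · have hr := hrleaf x h.1 h.2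
        exact Conn.of_adj hx (fun h => hr.1 (hSD h)) hr.2
    exact (hret x hx).trans ((h.mono hSD).trans (hret y hy).symm)
  have h1 := hu S hS
  have h2 := Set.ncard_inter_add_ncard_sdiff_eq_ncard D {x | IsLeaf G x} (Set.toFinite _)
  have h3 : S.ncard = (D \ {x | IsLeaf G x}).ncard := rfl
  omega

/-- The complement of a colour class is independent, so the count for $P$ reads
$|P|+1=|P^c|+\ell(P)$, where $\ell$ counts leaves. Adding the same equation for $P^c$ leaves
$\ell(P)+\ell(P^c)=2$. -/
theorem CutUnmixed.ncard_leaves [Finite V] (hu : CutUnmixed G) (hadj : ∀ x, ∃ y, G.Adj x y)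
    {P : Set V} (hP : ∀ x y, G.Adj x y → (x ∈ P ↔ y ∉ P)) : {x | IsLeaf G x}.ncard = 2 := by
  have key : ∀ D : Set V, (∀ x y, G.Adj x y → (x ∈ D ↔ y ∉ D)) →
      D.ncard + 1 = Dᶜ.ncard + (D ∩ {x | IsLeaf G x}).ncard := by
    intro D hD
    have hind : ∀ a b, a ∉ D → b ∉ D → ¬ G.Adj a b := fun a b ha hb hab => ha ((hD a b hab).2 hb)
    rw [← compCount_eq_of_indep hind]
    refine hu.ncard_add_one_eq (fun d hd _ => ?_) (fun d hd hl => ?_)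
    · obtain ⟨y, hy⟩ := hadj d
      exact ⟨y, (hD d y hy).1 hd, hy⟩
    · obtain ⟨a, b, hab, hda, hdb⟩ := exists_two_adj hl (hadj d)
      have ha := (hD d a hda).1 hd
      exact ⟨a, b, ha, (hD d b hdb).1 hd, hda, hdb,
        fun h => hab (h.eq_of_isolated fun c hc => hind a c ha hc)⟩
  have h1 := key P hP
  have h2 := key Pᶜ (fun x y hxy => by simpa using (hP y x hxy.symm).symm)
  rw [compl_compl] at h2
  have h3 := Set.ncard_inter_add_ncard_sdiff_eq_ncard {x | IsLeaf G x} P (Set.toFinite _)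
  rw [Set.sdiff_eq, Set.inter_comm, Set.inter_comm _ Pᶜ] at h3
  omega

/-- $D$ is a colour class up to the single inner edge $vw$. As before $|D|+1=|D^c|+\ell(D)$, but
removing $D^c$ leaves that edge, so $c(D^c)<|D|$. Adding $|D^c|+1=c(D^c)+\ell(D^c)$ gives at least
three leaves. -/
theorem CutUnmixed.three_le_ncard_leaves [Finite V] (hu : CutUnmixed G) (hadj : ∀ x, ∃ y, G.Adj x y)
    {D : Set V} {v w : V} (hv : v ∈ D) (hw : w ∈ D) (hvw : G.Adj v w)
    (hD : ∀ x y, G.Adj x y → (x ∈ D ↔ y ∉ D) ∨ (x = v ∧ y = w) ∨ (x = w ∧ y = v))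
    (htri : ∀ d, G.Adj d v → ¬ G.Adj d w)
    (hv2 : ∃ a b, a ≠ b ∧ a ≠ w ∧ b ≠ w ∧ G.Adj v a ∧ G.Adj v b)
    (hw2 : ∃ a b, a ≠ b ∧ a ≠ v ∧ b ≠ v ∧ G.Adj w a ∧ G.Adj w b) :
    3 ≤ {x | IsLeaf G x}.ncard := by
  have hleaf : ∀ x, (∃ a b, a ≠ b ∧ G.Adj x a ∧ G.Adj x b) → ¬ IsLeaf G x := by
    rintro x ⟨a, b, hab, ha, hb⟩ hx
    obtain ⟨y, -, hy⟩ := hx.exists_adj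
    exact hab ((hy a ha).trans (hy b hb).symm)
  have hvl : ¬ IsLeaf G v := by
    obtain ⟨a, b, hab, -, -, ha, hb⟩ := hv2
    exact hleaf v ⟨a, b, hab, ha, hb⟩
  have hwl : ¬ IsLeaf G w := by
    obtain ⟨a, b, hab, -, -, ha, hb⟩ := hw2
    exact hleaf w ⟨a, b, hab, ha, hb⟩
  have hne : v ≠ w := G.ne_of_adj hvw
  have hout : ∀ x y, x ∈ D → G.Adj x y → (x = v → y ≠ w) → (x = w → y ≠ v) → y ∉ D := by
    intro x y hx hxy h1 h2
    rcases hD x y hxy with h | h | h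
    · exact h.1 hx
    · exact (h1 h.1 h.2).elim
    · exact (h2 h.1 h.2).elim
  have hind : ∀ a b, a ∉ D → b ∉ D → ¬ G.Adj a b := by
    intro a b ha hb hab
    rcases hD a b hab with h | h | h
    · exact ha (h.2 hb)
    · exact ha (h.1 ▸ hv)
    · exact ha (h.1 ▸ hw)
  have h1 : D.ncard + 1 = Dᶜ.ncard + (D ∩ {x | IsLeaf G x}).ncard := by
    rw [← compCount_eq_of_indep hind]
    refine hu.ncard_add_one_eq (fun d hd hl => ?_) (fun d hd hl => ?_)
    · obtain ⟨y, hy⟩ := hadj d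
      exact ⟨y, hout d y hd hy (by rintro rfl; exact (hvl hl).elim)
        (by rintro rfl; exact (hwl hl).elim), hy⟩
    · obtain ⟨a, b, hab, ha, hb, hda, hdb⟩ :
          ∃ a b, a ≠ b ∧ a ∉ D ∧ b ∉ D ∧ G.Adj d a ∧ G.Adj d b := by
        by_cases hdv : d = v
        · subst hdv
          obtain ⟨a, b, hab, haw, hbw, ha, hb⟩ := hv2
          exact ⟨a, b, hab, hout _ _ hd ha (fun _ => haw) (fun h => (hne h).elim),
            hout _ _ hd hb (fun _ => hbw) (fun h => (hne h).elim), ha, hb⟩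
        by_cases hdw : d = w
        · subst hdw
          obtain ⟨a, b, hab, hav, hbv, ha, hb⟩ := hw2
          exact ⟨a, b, hab, hout _ _ hd ha (fun h => (hdv h).elim) (fun _ => hav),
            hout _ _ hd hb (fun h => (hdv h).elim) (fun _ => hbv), ha, hb⟩
        obtain ⟨a, b, hab, ha, hb⟩ := exists_two_adj hl (hadj d)
        exact ⟨a, b, hab, hout _ _ hd ha (fun h => (hdv h).elim) (fun h => (hdw h).elim),
            hout _ _ hd hb (fun h => (hdv h).elim) (fun h => (hdw h).elim), ha, hb⟩
      exact ⟨a, b, ha, hb, hda, hdb,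
        fun h => hab (h.eq_of_isolated fun c hc => hind a c ha hc)⟩
  have hin : ∀ x y, x ∉ D → G.Adj x y → y ∈ D := fun x y hx hxy =>
    not_not.1 fun hy => hind x y hx hy hxy
  have hiso : ∀ a ∈ D, a ≠ v → a ≠ w → ∀ c, c ∉ Dᶜ → ¬ G.Adj a c := by
    intro a ha hav haw c hc hac
    exact hc (hout a c ha hac (fun h => (hav h).elim) (fun h => (haw h).elim))
  have h2 : Dᶜ.ncard + 1 = compCount G Dᶜ + (Dᶜ ∩ {x | IsLeaf G x}).ncard := by
    refine hu.ncard_add_one_eq (fun d hd _ => ?_) (fun d hd hl => ?_)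
    · obtain ⟨y, hy⟩ := hadj d
      exact ⟨y, not_not.2 (hin d y hd hy), hy⟩
    · obtain ⟨a, b, hab, hda, hdb⟩ := exists_two_adj hl (hadj d)
      have ha := hin d a hd hda
      have hb := hin d b hd hdb
      refine ⟨a, b, not_not.2 ha, not_not.2 hb, hda, hdb, fun h => hab ?_⟩
      -- Two neighbours of $d$ could be joined inside $D$ only by the edge $vw$, which would form a
      -- triangle with $d$.
      by_cases hav : a = v ∨ a = w
      · refine (h.symm.eq_of_isolated (hiso b hb ?_ ?_)).symm
        · rintro rfl
          rcases hav with rfl | rfl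
          · exact hab rfl
          · exact htri d hdb hda
        · rintro rfl
          rcases hav with rfl | rfl
          · exact htri d hda hdb
          · exact hab rfl
      · push Not at hav
        exact h.eq_of_isolated (hiso a ha hav.1 hav.2)
  have h3 : compCount G Dᶜ < D.ncard := by
    have := compCount_lt_ncard (G := G) (Conn.of_adj (S := Dᶜ) (not_not.2 hv) (not_not.2 hw) hvw)
      hne
    rwa [compl_compl] at this
  have h4 := Set.ncard_inter_add_ncard_sdiff_eq_ncard {x | IsLeaf G x} D (Set.toFinite _)
  rw [Set.sdiff_eq, Set.inter_comm, Set.inter_comm _ Dᶜ] at h4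
  omega

/-- The edge $vw$ is a bridge. If $w$ had two further neighbours, exchanging the colours on the side
of $w$ would contradict the number of leaves. So $w$, not being a leaf, has degree two, and $G$ is a
$\ast$ at $w$. -/
theorem exists_isStar_of_bridge [Finite V] (hu : CutUnmixed G) (hadj : ∀ x, ∃ y, G.Adj x y)
    {P : Set V} (hP : ∀ x y, G.Adj x y → (x ∈ P ↔ y ∉ P)) {v w : V} {A B : Set V} (hs : Split G v A B)
    (hvleaf : ∀ x, G.Adj v x → ¬ IsLeaf G x) (hwA : w ∈ A) (hvw : G.Adj v w)
    (hw : ∀ x ∈ A, G.Adj v x → x = w)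
    (hB : ∃ a ∈ B, ∃ b ∈ B, a ≠ b ∧ G.Adj v a ∧ G.Adj v b) :
    ∃ C D : Set V, IsStar G (G.induce C) (G.induce D) := by
  have hcross : ∀ x y, x ∈ A → y ∉ A → G.Adj x y → x = w ∧ y = v := by
    intro x y hx hy hxy
    have hyv : y = v := not_not.1 fun h => hy (hs.mem_left_of_adj hx hxy h)
    subst hyv
    exact ⟨hw x hx hxy.symm, rfl⟩
  have hwv : w ≠ v := (G.ne_of_adj hvw).symm
  have hwout : ∀ x, G.Adj w x → x ≠ v → x ∈ A := fun x hx hxv => hs.mem_left_of_adj hwA hx hxv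
  by_cases hw2 : ∃ a b, a ≠ b ∧ a ≠ v ∧ b ≠ v ∧ G.Adj w a ∧ G.Adj w b
  · exfalso
    have hleaves := hu.ncard_leaves hadj hP
    have key : ∀ P : Set V, v ∈ P → (∀ x y, G.Adj x y → (x ∈ P ↔ y ∉ P)) →
        3 ≤ {x | IsLeaf G x}.ncard := by
      intro P hvP hP
      have hwP : w ∉ P := (hP v w hvw).1 hvP
      -- This set is $P$ outside $A$ and the complement of $P$ inside $A$; it contains both $v$ and
      -- $w$, and $vw$ is the only edge the recolouring spoils.
      refine hu.three_le_ncard_leaves hadj (D := {x | x ∈ A ↔ x ∉ P}) (v := v) (w := w)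
        ?_ ?_ hvw ?_ ?_ ?_ hw2
      · simp [hs.notMem_left, hvP]
      · simp [hwA, hwP]
      · intro x y hxy
        have hPxy := hP x y hxy
        by_cases hx : x ∈ A <;> by_cases hy : y ∈ A
        · left
          simp only [Set.mem_ofPred_eq, hx, hy]
          tauto
        · exact Or.inr (Or.inr (hcross x y hx hy hxy))
        · exact Or.inr (Or.inl (hcross y x hy hx hxy.symm).symm)
        · left
          simp only [Set.mem_ofPred_eq, hx, hy]
          tauto
      · intro d hdv hdw
        have h1 := hP d v hdv
        have h2 := hP d w hdw
        tauto
      · obtain ⟨a, ha, b, hb, hab, hva, hvb⟩ := hB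
        exact ⟨a, b, hab, by rintro rfl; exact hs.disjoint _ hwA ha,
          by rintro rfl; exact hs.disjoint _ hwA hb, hva, hvb⟩
    have : 3 ≤ {x | IsLeaf G x}.ncard := by
      by_cases hvP : v ∈ P
      · exact key P hvP hP
      · exact key Pᶜ hvP (fun x y hxy => by simpa using (hP y x hxy.symm).symm)
    omega
  · push Not at hw2
    obtain ⟨u, huv, hwu⟩ : ∃ u, u ≠ v ∧ G.Adj w u := by
      obtain ⟨a, b, hab, hwa, hwb⟩ := exists_two_adj (hvleaf w hvw) (hadj w)
      by_cases hav : a = v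
      · exact ⟨b, fun h => hab (hav.trans h.symm), hwb⟩
      · exact ⟨a, hav, hwa⟩
    have huw : u ≠ w := (G.ne_of_adj hwu).symm
    have huA := hwout u hwu huv
    have hsw : Split G w (A \ {w}) Aᶜ := by
      refine hu.split (fun h => h.2 rfl) (fun h => h hwA) (fun x hx hx' => hx' hx.1) (fun x => ?_)
        (fun a ha b hb hab => ha.2 (hcross a b ha.1 hb hab).1) ⟨u, ⟨huA, huw⟩, hwu⟩
        ⟨v, hs.notMem_left, hvw.symm⟩
      by_cases hxw : x = w
      · exact Or.inl hxw
      · by_cases hxA : x ∈ A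
        · exact Or.inr (Or.inl ⟨hxA, hxw⟩)
        · exact Or.inr (Or.inr hxA)
    refine ⟨_, _, hsw.isStar ⟨u, ⟨huA, huw⟩, hwu, fun x hx hwx => ?_⟩
      ⟨v, hs.notMem_left, hvw.symm, fun x hx hwx => (hcross w x hwA hx hwx).2⟩⟩
    by_contra hxu
    refine hw2 x u hxu ?_ huv hwx hwu
    rintro rfl
    exact hs.notMem_left hx.1

/-- A leaf has only one neighbour, so the two leaves account for at most two cut vertices. A third
one, adjacent to no leaf, is where the case distinction by numbers of neighbours takes place. -/
theorem exists_isStar_or_isCirc [Finite V] (hc : G.Connected) (hb : G.IsBipartite)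
    (hu : CutUnmixed G) (hcut : 3 ≤ {x : V | IsCutVertex G x}.ncard) :
    ∃ C D : Set V, IsStar G (G.induce C) (G.induce D) ∨ IsCirc G (G.induce C) (G.induce D) := by
  obtain ⟨c⟩ := hb
  let P : Set V := {x | c x = 0}
  have hP : ∀ x y, G.Adj x y → (x ∈ P ↔ y ∉ P) := by
    intro x y hxy
    have h : c x ≠ c y := c.valid hxy
    simp only [P, Set.mem_ofPred_eq]
    omega
  have hadj : ∀ x, ∃ y, G.Adj x y := by
    obtain ⟨a, -, b, -, hab⟩ := (Set.one_lt_ncard (Set.toFinite _)).1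
      (show 1 < {x : V | IsCutVertex G x}.ncard by omega)
    have : Nontrivial V := ⟨a, b, hab⟩
    exact fun x => hc.preconnected.exists_adj_of_nontrivial x
  have hleaves := hu.ncard_leaves hadj hP
  obtain ⟨v, hv, hvleaf⟩ : ∃ v, IsCutVertex G v ∧ ∀ x, G.Adj v x → ¬ IsLeaf G x := by
    by_contra hcon
    push Not at hcon
    -- Sending each cut vertex to an adjacent leaf would be an injection from at least three
    -- vertices to two leaves.
    choose! f hf hfl using hcon
    have := Set.ncard_le_ncard_of_injOn f (s := {x : V | IsCutVertex G x})
      (t := {x | IsLeaf G x}) hfl ?_ (Set.toFinite _)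
    · omega
    · intro x hx y hy hxy
      obtain ⟨z, -, hz⟩ := (hfl x hx).exists_adj
      have h1 := hz x (hf x hx).symm
      have h2 := hz y (by rw [hxy]; exact (hf y hy).symm)
      exact h1.trans h2.symm
  obtain ⟨A, B, hs⟩ := hu.exists_split hv
  have hdich : ∀ C : Set V, (∃ a ∈ C, G.Adj v a) →
      (∃ a ∈ C, ∃ b ∈ C, a ≠ b ∧ G.Adj v a ∧ G.Adj v b) ∨
      ∃ a ∈ C, G.Adj v a ∧ ∀ x ∈ C, G.Adj v x → x = a := by
    rintro C ⟨a, ha, hva⟩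
    by_cases h : ∃ b ∈ C, a ≠ b ∧ G.Adj v b
    · obtain ⟨b, hb, hab, hvb⟩ := h
      exact Or.inl ⟨a, ha, b, hb, hab, hva, hvb⟩
    · push Not at h
      exact Or.inr ⟨a, ha, hva, fun x hx hvx => not_not.1 fun hxa => h x hx (Ne.symm hxa) hvx⟩
  rcases hdich A hs.adj_left with hA | hA <;> rcases hdich B hs.adj_right with hB | hB
  · obtain ⟨c, d, h⟩ := hs.isCirc hA hB
    exact ⟨_, _, Or.inr h⟩
  · obtain ⟨w, hwB, hvw, hw⟩ := hB
    obtain ⟨C, D, h⟩ := exists_isStar_of_bridge hu hadj hP hs.symm hvleaf hwB hvw hw hA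
    exact ⟨C, D, Or.inl h⟩
  · obtain ⟨w, hwA, hvw, hw⟩ := hA
    obtain ⟨C, D, h⟩ := exists_isStar_of_bridge hu hadj hP hs hvleaf hwA hvw hw hB
    exact ⟨C, D, Or.inl h⟩
  · exact ⟨_, _, Or.inl (hs.isStar hA hB)⟩

end Leaves

end BinomialEdge

theorem theorem4p9 (K : Type v) [Field K] {V : Type u} [Finite V] (G : SimpleGraph V)
    (hconn : G.Connected) (hbip : G.IsBipartite)
    (hunm : BinomialEdge.Unmixed (BinomialEdge.binomialEdgeIdeal K G))
    (hcut : 3 ≤ {x : V | BinomialEdge.IsCutVertex G x}.ncard) :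
    (∃ (V₁ V₂ : Type u) (_ : Finite V₁) (_ : Finite V₂)
      (G₁ : SimpleGraph V₁) (G₂ : SimpleGraph V₂),
        BinomialEdge.IsStar G G₁ G₂ ∨ BinomialEdge.IsCirc G G₁ G₂) ∧
    (∀ (V₁ V₂ : Type u) [Finite V₁] [Finite V₂]
      (G₁ : SimpleGraph V₁) (G₂ : SimpleGraph V₂),
        (BinomialEdge.IsStar G G₁ G₂ ∨ BinomialEdge.IsCirc G G₁ G₂) →
        (BinomialEdge.dualGraph (BinomialEdge.binomialEdgeIdeal K G)).Connected →
          (BinomialEdge.dualGraph (BinomialEdge.binomialEdgeIdeal K G₁)).Connected ∧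
          (BinomialEdge.dualGraph (BinomialEdge.binomialEdgeIdeal K G₂)).Connected) := by
  have hu : BinomialEdge.CutUnmixed G := hunm.cutUnmixed hconn
  refine ⟨?_, ?_⟩
  · obtain ⟨C, D, h⟩ := BinomialEdge.exists_isStar_or_isCirc hconn hbip hu hcut
    exact ⟨_, _, inferInstance, inferInstance, _, _, h⟩
  · intro V₁ V₂ _ _ G₁ G₂ h hD
    obtain ⟨⟨e₁⟩, ⟨e₂⟩⟩ : Nonempty (BinomialEdge.LeafEmbedding G₁ G) ∧
        Nonempty (BinomialEdge.LeafEmbedding G₂ G) := by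
      rcases h with h | h
      · exact ⟨h.nonempty_leafEmbedding, h.symm.nonempty_leafEmbedding⟩
      · exact ⟨h.nonempty_leafEmbedding, h.symm.nonempty_leafEmbedding⟩
    exact ⟨e₁.dualGraph_connected K hconn hu hD, e₂.dualGraph_connected K hconn hu hD⟩
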